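/- Let $\alpha,\beta\in\mathbb R$ with $4\alpha-\beta^2>0$. On the plane, consider numbers $x+iy$ ($x,y\in\mathbb R$) multiplied according to $i^2=-\alpha-\beta i$. A function $w=u+iv$, with real differentiable $u,v$, is called holomorphic in an open set if $\partial_{\bar z}w=\tfrac12(\partial_x w+i\,\partial_y w)=0$ there, i.e. $\partial_x u-\alpha\,\partial_y v=0$ and $\partial_y u+\partial_x v-\beta\,\partial_y v=0$. Let $\Omega$ be a bounded domain in the plane, let $T>0$, and let the real coefficients of the system $$\partial_t u=a_{11}\partial_x u+a_{12}\partial_y u+a_{21}\partial_x v+a_{22}\partial_y v+c_1u+c_2v+c_3,$$ $$\partial_t v=b_{11}\partial_x u+b_{12}\partial_y u+b_{21}\partial_x v+b_{22}\partial_y v+d_1u+d_2v+d_3$$ be continuous functions of $(t,x,y)\in[0,T]\times\Omega$. (1) The space of holomorphic functions in $\Omega$ is associated to the system (that is, for each $t\in[0,T]$ the right-hand side maps every $w=u+iv$ holomorphic in $\Omega$ to a function holomorphic in $\Omega$) if and only if there are functions $A=A_1+iA_2$, $E=E_1+iE_2$, $G=G_1+iG_2$ on $[0,T]\times\Omega$,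 holomorphic in $z=x+iy\in\Omega$ for each $t$, with $$a_{21}=-\alpha A_2+a_{12},\quad a_{22}=\alpha A_1-\alpha a_{11}-\beta a_{12},\quad b_{21}=A_1-\beta A_2+b_{12},\quad b_{22}=\alpha A_2-\alpha b_{11}-\beta b_{12},$$ $$c_1=E_1,\quad d_1=E_2,\quad c_2=-\alpha E_2,\quad d_2=E_1-\beta E_2,\quad c_3=G_1,\quad d_3=G_2.$$ (2) Suppose that the coefficients have this form. Call a family $\Omega_s$, $0<s<s_0$, an exhaustion of $\Omega$ if $s_0>0$, the $\Omega_s$ are domains with union $\Omega$, $\overline{\Omega_s}\subset\Omega_{s'}$ for $s<s'$, and for some $c>0$ the distance of $\Omega_s$ from the complement of $\Omega$ is at least $c\,(s_0-s)$ for all $s$. Say that the initial value problem is solvable along $(\Omega_s)$ with constant $h$ if for every $\rho=\varphi+i\psi$ holomorphic in $\Omega$ there is one $w(t,z)=u(t,z)+iv(t,z)$ such that, for every $s\in(0,s_0)$, the pair $(u,v)$ is continuous and solves the system for $z\in\Omega_s$, $0\le t\le h(s_0-s)$ (with one-sided $t$-derivatives at the ends), $u(0,z)=\varphi(z)$ and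 $v(0,z)=\psi(z)$ for $z\in\Omega_s$, and $w(t,\cdot)$ is holomorphic in $\Omega_s$ for each such $t$. Then: (a) There are an exhaustion $(\Omega_s)_{0<s<s_0}$ of $\Omega$, for which moreover every point of $\Omega$ except one centre lies on $\partial\Omega_s$ for exactly one $s$, and an $h_0>0$ with $h_0s_0\le T$, such that the initial value problem is solvable along $(\Omega_s)$ with every constant $h\in(0,h_0]$. (b) If $A$ is bounded on $[0,T]\times\Omega$, then for every exhaustion $(\Omega_s)_{0<s<s_0}$ of $\Omega$ there is an $h_0>0$ with $h_0s_0\le T$, such that the initial value problem is solvable along $(\Omega_s)$ with every constant $h\in(0,h_0]$. -/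

import Mathlib

open Set Metric

noncomputable section

namespace EllipticCR

/-- The numbers `x + i y` with real `x`, `y` and `i ^ 2 = -α - β i`. -/
abbrev Num (α β : ℝ) : Type := QuadraticAlgebra ℝ (-α) (-β)

/-- The partial derivative in `x` of a real function in the plane. -/
def partialX (f : ℝ × ℝ → ℝ) (z : ℝ × ℝ) : ℝ := fderiv ℝ f z (1, 0)

/-- The partial derivative in `y` of a real function in the plane. -/
def partialY (f : ℝ × ℝ → ℝ) (z : ℝ × ℝ) : ℝ := fderiv ℝ f z (0, 1)

/-- The Cauchy-Riemann operator `(1/2) (∂ₓ w + i ∂_y w)` of `w = u + i v`, the product being that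
of `Num α β`. -/
def dbar {α β : ℝ} (w : ℝ × ℝ → Num α β) (z : ℝ × ℝ) : Num α β :=
  (1 / 2 : ℝ) •
    ((⟨partialX (fun p => (w p).re) z, partialX (fun p => (w p).im) z⟩ : Num α β) +
      (⟨0, 1⟩ : Num α β) *
        (⟨partialY (fun p => (w p).re) z, partialY (fun p => (w p).im) z⟩ : Num α β))

/-- `w = u + i v` is holomorphic in the open set `U` with respect to `X ^ 2 + β X + α`. -/
structure IsHolomorphicOn {α β : ℝ} (w : ℝ × ℝ → Num α β) (U : Set (ℝ × ℝ)) : Prop where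
  differentiableOn_re : DifferentiableOn ℝ (fun p => (w p).re) U
  differentiableOn_im : DifferentiableOn ℝ (fun p => (w p).im) U
  dbar_eq_zero : ∀ z ∈ U, dbar w z = 0

/-- The fourteen coefficients, functions of `t` and `z = (x, y)`, of the system
`∂ₜ u = a₁₁ ∂ₓ u + a₁₂ ∂_y u + a₂₁ ∂ₓ v + a₂₂ ∂_y v + c₁ u + c₂ v + c₃`,
`∂ₜ v = b₁₁ ∂ₓ u + b₁₂ ∂_y u + b₂₁ ∂ₓ v + b₂₂ ∂_y v + d₁ u + d₂ v + d₃`. -/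
structure RealSystem where
  (a₁₁ a₁₂ a₂₁ a₂₂ b₁₁ b₁₂ b₂₁ b₂₂ c₁ c₂ c₃ d₁ d₂ d₃ : ℝ → ℝ × ℝ → ℝ)

namespace RealSystem

/-- All coefficients are continuous in `(t, x, y)` for `0 ≤ t ≤ T` and `(x, y) ∈ Ω`. -/
def IsContinuous (S : RealSystem) (T : ℝ) (Ω : Set (ℝ × ℝ)) : Prop :=
  ∀ f ∈ [S.a₁₁, S.a₁₂, S.a₂₁, S.a₂₂, S.b₁₁, S.b₁₂, S.b₂₁, S.b₂₂,
      S.c₁, S.c₂, S.c₃, S.d₁, S.d₂, S.d₃],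
    ContinuousOn (fun p : ℝ × (ℝ × ℝ) => f p.1 p.2) (Icc 0 T ×ˢ Ω)

/-- The right-hand side of the first equation, at time `t` and at the point `z`. -/
def rhsU (S : RealSystem) (t : ℝ) (u v : ℝ × ℝ → ℝ) (z : ℝ × ℝ) : ℝ :=
  S.a₁₁ t z * partialX u z + S.a₁₂ t z * partialY u z
    + S.a₂₁ t z * partialX v z + S.a₂₂ t z * partialY v z
    + S.c₁ t z * u z + S.c₂ t z * v z + S.c₃ t z

/-- The right-hand side of the second equation, at time `t` and at the point `z`. -/
def rhsV (S : RealSystem) (t : ℝ) (u v : ℝ × ℝ → ℝ) (z : ℝ × ℝ) : ℝ :=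
  S.b₁₁ t z * partialX u z + S.b₁₂ t z * partialY u z
    + S.b₂₁ t z * partialX v z + S.b₂₂ t z * partialY v z
    + S.d₁ t z * u z + S.d₂ t z * v z + S.d₃ t z

/-- The right-hand side of the system at time `t`, as an operator on `w = u + i v`. -/
def rhs (S : RealSystem) {α β : ℝ} (t : ℝ) (w : ℝ × ℝ → Num α β) (z : ℝ × ℝ) : Num α β :=
  ⟨S.rhsU t (fun p => (w p).re) (fun p => (w p).im) z,
    S.rhsV t (fun p => (w p).re) (fun p => (w p).im) z⟩

/-- The space of holomorphic functions in `Ω` is associated to the system: at each time the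
right-hand side sends holomorphic functions to holomorphic functions. -/
def IsAssociated (S : RealSystem) (α β T : ℝ) (Ω : Set (ℝ × ℝ)) : Prop :=
  ∀ t ∈ Icc 0 T, ∀ w : ℝ × ℝ → Num α β,
    IsHolomorphicOn w Ω → IsHolomorphicOn (S.rhs t w) Ω

/-- The coefficients are those given by the functions `A = A₁ + i A₂`, `E` and `G`, holomorphic
in `z ∈ Ω` at each time, with `a₁₁`, `a₁₂`, `b₁₁`, `b₁₂` left free. -/
structure IsGivenBy (S : RealSystem) {α β : ℝ} (T : ℝ) (Ω : Set (ℝ × ℝ))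
    (A E G : ℝ → ℝ × ℝ → Num α β) : Prop where
  holomorphic_A : ∀ t ∈ Icc 0 T, IsHolomorphicOn (A t) Ω
  holomorphic_E : ∀ t ∈ Icc 0 T, IsHolomorphicOn (E t) Ω
  holomorphic_G : ∀ t ∈ Icc 0 T, IsHolomorphicOn (G t) Ω
  a₂₁_eq : ∀ t ∈ Icc 0 T, ∀ z ∈ Ω, S.a₂₁ t z = -α * (A t z).im + S.a₁₂ t z
  a₂₂_eq : ∀ t ∈ Icc 0 T, ∀ z ∈ Ω,
    S.a₂₂ t z = α * (A t z).re - α * S.a₁₁ t z - β * S.a₁₂ t z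
  b₂₁_eq : ∀ t ∈ Icc 0 T, ∀ z ∈ Ω,
    S.b₂₁ t z = (A t z).re - β * (A t z).im + S.b₁₂ t z
  b₂₂_eq : ∀ t ∈ Icc 0 T, ∀ z ∈ Ω,
    S.b₂₂ t z = α * (A t z).im - α * S.b₁₁ t z - β * S.b₁₂ t z
  c₁_eq : ∀ t ∈ Icc 0 T, ∀ z ∈ Ω, S.c₁ t z = (E t z).re
  d₁_eq : ∀ t ∈ Icc 0 T, ∀ z ∈ Ω, S.d₁ t z = (E t z).im
  c₂_eq : ∀ t ∈ Icc 0 T, ∀ z ∈ Ω, S.c₂ t z = -α * (E t z).im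
  d₂_eq : ∀ t ∈ Icc 0 T, ∀ z ∈ Ω, S.d₂ t z = (E t z).re - β * (E t z).im
  c₃_eq : ∀ t ∈ Icc 0 T, ∀ z ∈ Ω, S.c₃ t z = (G t z).re
  d₃_eq : ∀ t ∈ Icc 0 T, ∀ z ∈ Ω, S.d₃ t z = (G t z).im

/-- `u`, `v` solve the system, with initial values `φ`, `ψ`, on `D` for `0 ≤ t ≤ τ`. The time
derivatives at the two ends of the interval are one-sided. -/
structure IsSolutionOn (S : RealSystem) (τ : ℝ) (D : Set (ℝ × ℝ)) (φ ψ : ℝ × ℝ → ℝ)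
    (u v : ℝ → ℝ × ℝ → ℝ) : Prop where
  continuousOn_u : ContinuousOn (fun p : ℝ × (ℝ × ℝ) => u p.1 p.2) (Icc 0 τ ×ˢ D)
  continuousOn_v : ContinuousOn (fun p : ℝ × (ℝ × ℝ) => v p.1 p.2) (Icc 0 τ ×ˢ D)
  differentiableOn_u : ∀ t ∈ Icc 0 τ, DifferentiableOn ℝ (u t) D
  differentiableOn_v : ∀ t ∈ Icc 0 τ, DifferentiableOn ℝ (v t) D
  initial_u : ∀ z ∈ D, u 0 z = φ z
  initial_v : ∀ z ∈ D, v 0 z = ψ z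
  hasDeriv_u : ∀ t ∈ Icc 0 τ, ∀ z ∈ D,
    HasDerivWithinAt (fun r => u r z) (S.rhsU t (u t) (v t) z) (Icc 0 τ) t
  hasDeriv_v : ∀ t ∈ Icc 0 τ, ∀ z ∈ D,
    HasDerivWithinAt (fun r => v r z) (S.rhsV t (u t) (v t) z) (Icc 0 τ) t

/-- For every `ρ = φ + i ψ` holomorphic in `Ω` there is one `w = u + i v` that solves the initial
value problem on each `D s`, `0 < s < s₀`, for `0 ≤ t ≤ h (s₀ - s)`, and is holomorphic in `z`
there at each time. -/
def IsSolvableAlong (S : RealSystem) (α β : ℝ) (Ω : Set (ℝ × ℝ)) (s₀ : ℝ)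
    (D : ℝ → Set (ℝ × ℝ)) (h : ℝ) : Prop :=
  ∀ ρ : ℝ × ℝ → Num α β, IsHolomorphicOn ρ Ω →
    ∃ w : ℝ → ℝ × ℝ → Num α β, ∀ s ∈ Ioo 0 s₀,
      S.IsSolutionOn (h * (s₀ - s)) (D s) (fun z => (ρ z).re) (fun z => (ρ z).im)
        (fun t z => (w t z).re) (fun t z => (w t z).im) ∧
      ∀ t ∈ Icc 0 (h * (s₀ - s)), IsHolomorphicOn (w t) (D s)

end RealSystem

/-- An exhaustion of the domain `Ω` by subdomains `D s`, `0 < s < s₀`, for which `s₀ - s` measures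
the distance from the boundary of `Ω`: up to a constant factor it is a lower bound for the distance
from `D s` to the complement of `Ω`. (The maximum distance in the plane is used; the factor
makes the choice of the norm irrelevant.) -/
structure IsExhaustion (Ω : Set (ℝ × ℝ)) (s₀ : ℝ) (D : ℝ → Set (ℝ × ℝ)) : Prop where
  pos : 0 < s₀
  isOpen : ∀ s ∈ Ioo 0 s₀, IsOpen (D s)
  isConnected : ∀ s ∈ Ioo 0 s₀, IsConnected (D s)
  closure_subset : ∀ s ∈ Ioo 0 s₀, ∀ s' ∈ Ioo 0 s₀, s < s' → closure (D s) ⊆ D s'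
  iUnion_eq : ⋃ s ∈ Ioo 0 s₀, D s = Ω
  le_dist : ∃ c > 0, ∀ s ∈ Ioo 0 s₀, ∀ z ∈ D s, ∀ y ∉ Ω, c * (s₀ - s) ≤ dist z y

/-- Every point of `Ω`, except one centre, lies on the boundary of exactly one `D s`. -/
def IsFoliated (Ω : Set (ℝ × ℝ)) (s₀ : ℝ) (D : ℝ → Set (ℝ × ℝ)) : Prop :=
  ∃ z₀ ∈ Ω, ∀ z ∈ Ω, z ≠ z₀ → ∃! s, s ∈ Ioo 0 s₀ ∧ z ∈ frontier (D s)

end EllipticCR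

end

/-! The polynomial `X ^ 2 + β X + α` has a nonreal root `l`. Sending `i` to `l` identifies `Num α β`
with `ℂ`, and in the coordinate `ζ = x - y / l` holomorphy for `dbar` is ordinary complex holomorphy
with `d/dζ = ∂ₓ`. For coefficients of the stated form the free ones only multiply the Cauchy-Riemann
equations, so on holomorphic `w` the system reads `∂ₜ W = a W' + e W + g`.

Necessity. On holomorphic `w` the right-hand side is a real-linear first order expression in `W'`
and `W` plus a free term. Testing it on `0`, `1`, `ζ`, `ζ - ζ₀`, `(ζ - ζ₀) ^ 2` and their multiples
by `i` forces complex linearity and holomorphic coefficients (`complexLinear_of_preserves`).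

Existence. The Picard corrections are estimated by the distance to the surface of a cone. Cauchy's
estimate for the derivative costs one power of that distance, and integration in time along the cone
regains it. The series therefore converges near `(t, z)` as soon as `8 K |t| < R`, where `K` bounds
`a` on the closed ball of radius `R` about `z` (`exists_norm_picardTerm_le`, `exists_solution`). The
series does not depend on the ball, so one function solves the problem wherever such a cone fits.

For bounded `A`, a fixed `K` and a radius proportional to `s₀ - s` suffice. In general,
`exists_lipschitz_admissible` gives a 1-Lipschitz weight `e` such that `A` is bounded by `2 / e z`
on the ball of radius `e z / 2`, so times up to a multiple of `e ^ 2` are allowed. The exhaustion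
consists of the sublevel sets of an intrinsic distance with density `1 / e`, which grows at least
like `-log e`. The maximality of this distance makes its sublevel sets connected and excludes local
minima off the centre, hence the foliation. -/

noncomputable section

namespace EllipticCR

open Filter Topology

/-! ### Intrinsic distance with density `1 / e`, defined by duality instead of by paths -/

/-- Functions vanishing at `z₀` that, on every ball inside `Ω`, are Lipschitz with any constant
bounding `1 / e` there. -/
def lipschitzFamily {E : Type*} [PseudoMetricSpace E] (Ω : Set E) (e : E → ℝ) (z₀ : E) :
    Set (E → ℝ) :=
  {f | f z₀ = 0 ∧ ∀ z ρ K, ball z ρ ⊆ Ω → (∀ y ∈ ball z ρ, 1 / e y ≤ K) →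
    ∀ p ∈ ball z ρ, ∀ q ∈ ball z ρ, f p - f q ≤ K * dist p q}

/-- The intrinsic distance to `z₀` for the metric with density `1 / e`. -/
def intrinsicDist {E : Type*} [PseudoMetricSpace E] (Ω : Set E) (e : E → ℝ) (z₀ z : E) : ℝ :=
  sSup ((fun f : E → ℝ => f z) '' lipschitzFamily Ω e z₀)

theorem inter_frontier_nonempty_of_isPreconnected {X : Type*} [TopologicalSpace X] {s t : Set X}
    (hs : IsPreconnected s) (h1 : (s ∩ t).Nonempty) (h2 : (s ∩ tᶜ).Nonempty) :
    (s ∩ frontier t).Nonempty := by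
  by_contra hcon
  have hnf : ∀ x ∈ s, x ∉ frontier t := fun x hx hf => hcon ⟨x, hx, hf⟩
  have hmem : ∀ x ∈ s, x ∈ t → x ∈ interior t := fun x hx ht => by
    by_contra h
    exact hnf x hx ⟨subset_closure ht, h⟩
  have hnmem : ∀ x ∈ s, x ∉ t → x ∈ (closure t)ᶜ := fun x hx ht h =>
    hnf x hx ⟨h, fun h' => ht (interior_subset h')⟩
  obtain ⟨x, hx, hx1, hx2⟩ := hs (interior t) (closure t)ᶜ isOpen_interior
    isClosed_closure.isOpen_compl
    (fun x hx => (em (x ∈ t)).imp (hmem x hx) (hnmem x hx))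
    (h1.imp fun x hx => ⟨hx.1, hmem x hx.1 hx.2⟩) (h2.imp fun x hx => ⟨hx.1, hnmem x hx.1 hx.2⟩)
  exact hx2 (subset_closure (interior_subset hx1))

section Lipschitz

variable {E : Type*} [PseudoMetricSpace E] {Ω : Set E} {e : E → ℝ} {z₀ : E}


theorem zero_mem_lipschitzFamily (hpos : ∀ z ∈ Ω, 0 < e z) :
    (fun _ => 0) ∈ lipschitzFamily Ω e z₀ := by
  refine ⟨rfl, fun z ρ K hb hK p hp q _ => ?_⟩
  have h1 := hK p hp
  have h2 : 0 < 1 / e p := one_div_pos.2 (hpos p (hb hp))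
  have h3 : 0 ≤ K * dist p q := mul_nonneg (by linarith) dist_nonneg
  simpa using h3

theorem ball_subset_of_lipschitz (hlip : ∀ p q, e p - e q ≤ dist p q)
    (hoff : ∀ z ∉ Ω, e z = 0) (z : E) : ball z (e z) ⊆ Ω := by
  intro y hy
  by_contra h
  have := hlip z y
  rw [hoff y h, dist_comm] at this
  have := mem_ball.1 hy
  linarith

/-- Since `e` is 1-Lipschitz, it is at least `e z / 2` on the ball of radius `e z / 2`. The constant
is the same for the whole family, so it survives the supremum. -/
theorem sub_le_two_of_mem_lipschitzFamily (hlip : ∀ p q, e p - e q ≤ dist p q)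
    (hpos : ∀ z ∈ Ω, 0 < e z) (hoff : ∀ z ∉ Ω, e z = 0) {z : E} (hz : z ∈ Ω) {f : E → ℝ}
    (hf : f ∈ lipschitzFamily Ω e z₀) {p q : E} (hp : p ∈ ball z (e z / 2))
    (hq : q ∈ ball z (e z / 2)) : f p - f q ≤ 2 / e z * dist p q := by
  have hez := hpos z hz
  refine hf.2 z (e z / 2) (2 / e z)
    ((ball_subset_ball (by linarith)).trans (ball_subset_of_lipschitz hlip hoff z)) ?_ p hp q hq
  intro y hy
  have h1 := hlip z y
  rw [dist_comm] at h1
  have h2 := mem_ball.1 hy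
  rw [div_le_div_iff₀ (by linarith) hez]
  linarith

/-- The points where the family is bounded form a set that is open and relatively closed in `Ω`,
because a bound at one point of a ball of radius `e x / 2` spreads over the ball. It contains `z₀`,
so connectedness gives all of `Ω`. -/
theorem bddAbove_lipschitzFamily (hconn : IsConnected Ω) (hlip : ∀ p q, e p - e q ≤ dist p q)
    (hpos : ∀ z ∈ Ω, 0 < e z) (hoff : ∀ z ∉ Ω, e z = 0) (hz₀ : z₀ ∈ Ω) {z : E} (hz : z ∈ Ω) :
    BddAbove ((fun f : E → ℝ => f z) '' lipschitzFamily Ω e z₀) := by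
  set u : Set E := {z | z ∈ Ω ∧ BddAbove ((fun f : E → ℝ => f z) '' lipschitzFamily Ω e z₀)}
  have key : ∀ x ∈ Ω, ∀ p ∈ ball x (e x / 2), p ∈ u → ball x (e x / 2) ⊆ u := by
    intro x hx p hp hpu q hq
    have hex := hpos x hx
    refine ⟨ball_subset_of_lipschitz hlip hoff x (ball_subset_ball (by linarith) hq), ?_⟩
    obtain ⟨B, hB⟩ := hpu.2
    refine ⟨B + 2 / e x * dist q p, ?_⟩
    rintro _ ⟨f, hf, rfl⟩
    have h1 := sub_le_two_of_mem_lipschitzFamily hlip hpos hoff hx hf hq hp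
    have h2 := hB ⟨f, hf, rfl⟩
    simp only at h2 ⊢
    linarith
  have hsub : Ω ⊆ u := by
    refine hconn.isPreconnected.subset_of_closure_inter_subset ?_ ⟨z₀, hz₀, hz₀, 0, ?_⟩ ?_
    · rw [Metric.isOpen_iff]
      intro x hx
      have := hpos x hx.1
      exact ⟨e x / 2, by linarith, key x hx.1 x (mem_ball_self (by linarith)) hx⟩
    · rintro _ ⟨f, hf, rfl⟩
      exact hf.1.le
    · rintro x ⟨hx, hxΩ⟩
      have h0 := hpos x hxΩ
      obtain ⟨p, hp, hd⟩ := Metric.mem_closure_iff.1 hx (e x / 2) (by linarith)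
      exact key x hxΩ p (by rwa [mem_ball, dist_comm]) hp (mem_ball_self (by linarith))
  exact (hsub hz).2

theorem le_intrinsicDist (hconn : IsConnected Ω) (hlip : ∀ p q, e p - e q ≤ dist p q)
    (hpos : ∀ z ∈ Ω, 0 < e z) (hoff : ∀ z ∉ Ω, e z = 0) (hz₀ : z₀ ∈ Ω) {z : E} (hz : z ∈ Ω)
    {f : E → ℝ} (hf : f ∈ lipschitzFamily Ω e z₀) : f z ≤ intrinsicDist Ω e z₀ z :=
  le_csSup (bddAbove_lipschitzFamily hconn hlip hpos hoff hz₀ hz) ⟨f, hf, rfl⟩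

theorem intrinsicDist_mem (hconn : IsConnected Ω) (hlip : ∀ p q, e p - e q ≤ dist p q)
    (hpos : ∀ z ∈ Ω, 0 < e z) (hoff : ∀ z ∉ Ω, e z = 0) (hz₀ : z₀ ∈ Ω) :
    intrinsicDist Ω e z₀ ∈ lipschitzFamily Ω e z₀ := by
  have hne : (lipschitzFamily Ω e z₀).Nonempty := ⟨_, zero_mem_lipschitzFamily hpos⟩
  refine ⟨?_, fun z ρ K hb hK p hp q hq => ?_⟩
  · refine le_antisymm (csSup_le (hne.image _) ?_) ?_
    · rintro _ ⟨f, hf, rfl⟩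
      exact hf.1.le
    · exact le_intrinsicDist hconn hlip hpos hoff hz₀ hz₀ (zero_mem_lipschitzFamily hpos)
  · rw [sub_le_iff_le_add]
    refine csSup_le (hne.image _) ?_
    rintro _ ⟨f, hf, rfl⟩
    have h1 := hf.2 z ρ K hb hK p hp q hq
    have h2 := le_intrinsicDist hconn hlip hpos hoff hz₀ (hb hq) hf
    simp only
    linarith

theorem intrinsicDist_nonneg (hconn : IsConnected Ω) (hlip : ∀ p q, e p - e q ≤ dist p q)
    (hpos : ∀ z ∈ Ω, 0 < e z) (hoff : ∀ z ∉ Ω, e z = 0) (hz₀ : z₀ ∈ Ω) {z : E} (hz : z ∈ Ω) :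
    0 ≤ intrinsicDist Ω e z₀ z :=
  le_intrinsicDist hconn hlip hpos hoff hz₀ hz (zero_mem_lipschitzFamily hpos)

/-- The function `log (e z₀) - log e` is itself a competitor, as `log` has slope `1 / e` at `e`.
This is what makes the intrinsic distance blow up at the boundary of `Ω`. -/
theorem log_sub_log_le_intrinsicDist (hconn : IsConnected Ω)
    (hlip : ∀ p q, e p - e q ≤ dist p q)
    (hpos : ∀ z ∈ Ω, 0 < e z) (hoff : ∀ z ∉ Ω, e z = 0) (hz₀ : z₀ ∈ Ω) {z : E} (hz : z ∈ Ω) :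
    Real.log (e z₀) - Real.log (e z) ≤ intrinsicDist Ω e z₀ z := by
  refine le_intrinsicDist hconn hlip hpos hoff hz₀ hz
    (f := fun z => Real.log (e z₀) - Real.log (e z)) ⟨by simp, fun x ρ K hb hK p hp q hq => ?_⟩
  have hp0 := hpos p (hb hp)
  have hq0 := hpos q (hb hq)
  have h1 := Real.log_le_sub_one_of_pos (div_pos hq0 hp0)
  rw [Real.log_div hq0.ne' hp0.ne'] at h1
  have h2 : e q / e p - 1 = 1 / e p * (e q - e p) := by field_simp
  have h3 : 1 / e p * (e q - e p) ≤ K * dist p q := by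
    have h4 : e q - e p ≤ dist p q := by rw [dist_comm]; exact hlip q p
    calc 1 / e p * (e q - e p) ≤ 1 / e p * dist p q :=
          mul_le_mul_of_nonneg_left h4 (one_div_pos.2 hp0).le
      _ ≤ K * dist p q := mul_le_mul_of_nonneg_right (hK p hp) dist_nonneg
  linarith

theorem continuousOn_intrinsicDist (hconn : IsConnected Ω)
    (hlip : ∀ p q, e p - e q ≤ dist p q)
    (hpos : ∀ z ∈ Ω, 0 < e z) (hoff : ∀ z ∉ Ω, e z = 0) (hz₀ : z₀ ∈ Ω) :
    ContinuousOn (intrinsicDist Ω e z₀) Ω := by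
  intro z hz
  have hez := hpos z hz
  have hr := intrinsicDist_mem hconn hlip hpos hoff hz₀
  have hL : LipschitzOnWith (Real.toNNReal (2 / e z)) (intrinsicDist Ω e z₀)
      (ball z (e z / 2)) := by
    refine LipschitzOnWith.of_dist_le_mul fun p hp q hq => ?_
    rw [Real.coe_toNNReal _ (by positivity), Real.dist_eq, abs_le]
    have h1 := sub_le_two_of_mem_lipschitzFamily hlip hpos hoff hz hr hp hq
    have h2 := sub_le_two_of_mem_lipschitzFamily hlip hpos hoff hz hr hq hp
    rw [dist_comm] at h2
    constructor <;> linarith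
  exact (hL.continuousOn.continuousAt (ball_mem_nhds z (by linarith))).continuousWithinAt

end Lipschitz

/-! ### Sublevel sets of the intrinsic distance and the foliated exhaustion -/

section Foliation

variable {E : Type*} [NormedAddCommGroup E] [NormedSpace ℝ E] {Ω : Set E} {e : E → ℝ} {z₀ : E}

/-- Comparison principle for the intrinsic distance. -/
theorem le_intrinsicDist_of_le_frontier (hconn : IsConnected Ω)
    (hlip : ∀ p q, e p - e q ≤ dist p q)
    (hpos : ∀ z ∈ Ω, 0 < e z) (hoff : ∀ z ∉ Ω, e z = 0) (hle : ∀ z, e z ≤ 1) (hz₀ : z₀ ∈ Ω)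
    {C : Set E} (hz₀C : z₀ ∉ C) {g : E → ℝ} (hg : ∀ p q, g p - g q ≤ dist p q)
    (hfr : ∀ p ∈ frontier C, p ∈ Ω → g p ≤ intrinsicDist Ω e z₀ p) {z : E} (hz : z ∈ Ω)
    (hzC : z ∈ C) : g z ≤ intrinsicDist Ω e z₀ z := by
  classical
  set r := intrinsicDist Ω e z₀
  have hr : r ∈ lipschitzFamily Ω e z₀ := intrinsicDist_mem hconn hlip hpos hoff hz₀
  -- The intrinsic distance is the largest member of the family, so it is enough that raising it to
  -- `max r g` on `C` stays inside the family.
  have hf : (fun p => if p ∈ C then max (r p) (g p) else r p) ∈ lipschitzFamily Ω e z₀ := by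
    refine ⟨by simp [hz₀C, hr.1], fun x ρ K hb hK p hp q hq => ?_⟩
    have hK1 : 1 ≤ K := by
      refine le_trans ?_ (hK p hp)
      rw [le_div_iff₀ (hpos p (hb hp))]
      linarith [hle p]
    have hrL := hr.2 x ρ K hb hK
    have hgL : ∀ p q, g p - g q ≤ K * dist p q := fun p q =>
      (hg p q).trans (le_mul_of_one_le_left dist_nonneg hK1)
    have hpq := hrL p hp q hq
    by_cases hpC : p ∈ C <;> by_cases hqC : q ∈ C <;> simp only [hpC, hqC, if_true, if_false]
    · rw [sub_le_iff_le_add]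
      have := hgL p q
      refine max_le ?_ ?_
      · linarith [le_max_left (r q) (g q)]
      · linarith [le_max_right (r q) (g q)]
    · rw [sub_le_iff_le_add]
      refine max_le (by linarith) ?_
      -- The segment from `p` to `q` leaves `C` at some `m`, where `g ≤ r`. Use the bound for `g` up
      -- to `m` and the bound for `r` after it; the distances add along the segment.
      obtain ⟨m, hm, hmC⟩ := inter_frontier_nonempty_of_isPreconnected
        (convex_segment (𝕜 := ℝ) p q).isPreconnected (t := C)
        ⟨p, left_mem_segment ℝ p q, hpC⟩ ⟨q, right_mem_segment ℝ p q, hqC⟩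
      have hmb : m ∈ ball x ρ := (convex_ball x ρ).segment_subset hp hq hm
      have h1 := hgL p m
      have h2 := hfr m hmC (hb hmb)
      have h3 := hrL m hmb q hq
      have h4 := dist_add_dist_of_mem_segment hm
      have h5 : K * dist p q = K * dist p m + K * dist m q := by rw [← h4]; ring
      change g m ≤ r m at h2
      linarith
    · linarith [le_max_left (r q) (g q)]
    · exact hpq
  have h := le_intrinsicDist hconn hlip hpos hoff hz₀ hz hf
  simp only [hzC, if_true] at h
  exact (le_max_right _ _).trans h

/-- A component of the sublevel set missing `z₀` would have distance at least `s` on its frontier in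
`Ω`. Comparison with the constant `s` then gives at least `s` inside as well, which is absurd. -/
theorem isConnected_intrinsicDist_lt (hopen : IsOpen Ω) (hconn : IsConnected Ω)
    (hlip : ∀ p q, e p - e q ≤ dist p q)
    (hpos : ∀ z ∈ Ω, 0 < e z) (hoff : ∀ z ∉ Ω, e z = 0) (hle : ∀ z, e z ≤ 1) (hz₀ : z₀ ∈ Ω)
    {s : ℝ} (hs : 0 < s) : IsConnected {z | z ∈ Ω ∧ intrinsicDist Ω e z₀ z < s} := by
  set r := intrinsicDist Ω e z₀
  set U : Set E := {z | z ∈ Ω ∧ r z < s}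
  have hU : IsOpen U :=
    (continuousOn_intrinsicDist hconn hlip hpos hoff hz₀).isOpen_inter_preimage hopen isOpen_Iio
  have hz₀U : z₀ ∈ U :=
    ⟨hz₀, (intrinsicDist_mem hconn hlip hpos hoff hz₀).1.trans_lt hs⟩
  have hmem : ∀ z ∈ U, z₀ ∈ connectedComponentIn U z := by
    intro z hz
    by_contra hcon
    have hCo : IsOpen (connectedComponentIn U z) := hU.connectedComponentIn
    have h := le_intrinsicDist_of_le_frontier hconn hlip hpos hoff hle hz₀ hcon
      (g := fun _ => s) (fun p q => by simp) ?_ hz.1 (mem_connectedComponentIn hz)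
    · exact absurd hz.2 (not_lt.2 h)
    · intro p hp hpΩ
      by_contra hlt
      have hpU : p ∈ U := ⟨hpΩ, not_le.1 hlt⟩
      have hpo : IsOpen (connectedComponentIn U p) := hU.connectedComponentIn
      obtain ⟨q, hq1, hq2⟩ := mem_closure_iff.1 hp.1 _ hpo (mem_connectedComponentIn hpU)
      have : connectedComponentIn U p = connectedComponentIn U z :=
        (connectedComponentIn_eq hq1).trans (connectedComponentIn_eq hq2).symm
      have hpz : p ∈ connectedComponentIn U z := this ▸ mem_connectedComponentIn hpU
      exact hp.2 (hCo.interior_eq.symm ▸ hpz)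
  have hUeq : U = connectedComponentIn U z₀ := by
    refine Subset.antisymm (fun z hz => ?_) (connectedComponentIn_subset _ _)
    rw [← connectedComponentIn_eq (hmem z hz)]
    exact mem_connectedComponentIn hz
  rw [hUeq]
  exact ⟨⟨z₀, mem_connectedComponentIn hz₀U⟩, isPreconnected_connectedComponentIn⟩

/-- At a local minimum other than `z₀`, comparison on a small ball with a cone of slope one, equal
to the minimal value on the sphere, would push the value at the centre up by the radius `η`. -/
theorem exists_intrinsicDist_lt (hopen : IsOpen Ω) (hconn : IsConnected Ω)
    (hlip : ∀ p q, e p - e q ≤ dist p q)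
    (hpos : ∀ z ∈ Ω, 0 < e z) (hoff : ∀ z ∉ Ω, e z = 0) (hle : ∀ z, e z ≤ 1) (hz₀ : z₀ ∈ Ω)
    {z : E} (hz : z ∈ Ω) (hne : z ≠ z₀) {δ : ℝ} (hδ : 0 < δ) :
    ∃ y ∈ ball z δ, y ∈ Ω ∧ intrinsicDist Ω e z₀ y < intrinsicDist Ω e z₀ z := by
  by_contra! hmin
  obtain ⟨ε, hε, hεΩ⟩ := Metric.isOpen_iff.1 hopen z hz
  have hd : 0 < dist z₀ z := dist_pos.2 hne.symm
  obtain ⟨η, hη, hη'⟩ : ∃ η > 0, η < δ ∧ η < ε ∧ η < dist z₀ z :=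
    ⟨min δ (min ε (dist z₀ z)) / 2, by positivity, by
      have h1 := min_le_left δ (min ε (dist z₀ z))
      have h2 := min_le_right δ (min ε (dist z₀ z))
      have h3 := min_le_left ε (dist z₀ z)
      have h4 := min_le_right ε (dist z₀ z)
      have : 0 < min δ (min ε (dist z₀ z)) := by positivity
      refine ⟨?_, ?_, ?_⟩ <;> linarith⟩
  have h := le_intrinsicDist_of_le_frontier hconn hlip hpos hoff hle hz₀
    (C := ball z η) (fun h => by have := mem_ball.1 h; linarith [hη'.2.2])
    (g := fun q => intrinsicDist Ω e z₀ z + η - dist q z) (fun p q => ?_) ?_ hz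
    (mem_ball_self hη)
  · simp at h
    linarith
  · have := dist_triangle_left q z p
    linarith
  · intro p hp hpΩ
    have hps : dist p z = η := mem_sphere.1 (frontier_ball_subset_sphere hp)
    have := hmin p (by rw [mem_ball]; linarith [hη'.1]) hpΩ
    linarith

end Foliation

/-- A domain with a `1`-Lipschitz weight `e`, positive inside and zero outside, has a foliated
exhaustion along which `1 - s` is controlled by `e ^ 2`. -/
theorem exists_foliated_exhaustion {Ω : Set (ℝ × ℝ)} {e : ℝ × ℝ → ℝ} (hopen : IsOpen Ω)
    (hconn : IsConnected Ω) (hlip : ∀ p q, e p - e q ≤ dist p q)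
    (hpos : ∀ z ∈ Ω, 0 < e z) (hoff : ∀ z ∉ Ω, e z = 0) (hle : ∀ z, e z ≤ 1) :
    ∃ D : ℝ → Set (ℝ × ℝ), IsExhaustion Ω 1 D ∧ IsFoliated Ω 1 D ∧
      ∃ c > 0, ∀ s ∈ Ioo (0 : ℝ) 1, ∀ z ∈ D s, c * (1 - s) ≤ e z ^ 2 := by
  obtain ⟨z₀, hz₀⟩ := hconn.nonempty
  set r := intrinsicDist Ω e z₀
  have hrc : ContinuousOn r Ω := continuousOn_intrinsicDist hconn hlip hpos hoff hz₀
  have hr0 : ∀ z ∈ Ω, 0 ≤ r z := fun z hz => intrinsicDist_nonneg hconn hlip hpos hoff hz₀ hz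
  -- The levels are rescaled to `[0, 1)`. The factor 2 in the exponent turns `exp (-r) ≤ e z / e z₀`
  -- into control of `1 - s` by `e ^ 2`, the order of the admissible time.
  set q : ℝ × ℝ → ℝ := fun z => 1 - Real.exp (-(2 * r z))
  have hq_lt : ∀ y z, r y < r z → q y < q z := fun y z h => by
    have : Real.exp (-(2 * r z)) < Real.exp (-(2 * r y)) := Real.exp_lt_exp.2 (by linarith)
    simp only [q]; linarith
  have hqc : ContinuousOn q Ω := by
    refine continuousOn_const.sub (Real.continuous_exp.comp_continuousOn ?_)
    exact (hrc.const_smul (2 : ℝ)).neg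
  have hq1 : ∀ z, q z < 1 := fun z => by simp only [q]; linarith [Real.exp_pos (-(2 * r z))]
  have hbound : ∀ s, ∀ z ∈ Ω, q z < s → e z₀ ^ 2 * (1 - s) ≤ e z ^ 2 := by
    intro s z hz hs
    have h1 : Real.log (e z₀) - Real.log (e z) ≤ r z :=
      log_sub_log_le_intrinsicDist hconn hlip hpos hoff hz₀ hz
    have h2 : e z₀ * Real.exp (-r z) ≤ e z := by
      calc e z₀ * Real.exp (-r z) = Real.exp (Real.log (e z₀) - r z) := by
            rw [sub_eq_add_neg, Real.exp_add, Real.exp_log (hpos _ hz₀)]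
        _ ≤ Real.exp (Real.log (e z)) := Real.exp_le_exp.2 (by linarith)
        _ = e z := Real.exp_log (hpos _ hz)
    have h3 : Real.exp (-(2 * r z)) = Real.exp (-r z) ^ 2 := by
      rw [← Real.exp_nat_mul]; congr 1; push_cast; ring
    have h4 : 1 - s ≤ Real.exp (-r z) ^ 2 := by rw [← h3]; simp only [q] at hs; linarith
    calc e z₀ ^ 2 * (1 - s) ≤ e z₀ ^ 2 * Real.exp (-r z) ^ 2 :=
          mul_le_mul_of_nonneg_left h4 (sq_nonneg _)
      _ = (e z₀ * Real.exp (-r z)) ^ 2 := by ring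
      _ ≤ e z ^ 2 := pow_le_pow_left₀
          (mul_nonneg (hpos _ hz₀).le (Real.exp_pos _).le) h2 2
  have hc : 0 < e z₀ ^ 2 := pow_pos (hpos _ hz₀) 2
  have he0 : ∀ z, 0 ≤ e z := fun z => by
    by_cases hz : z ∈ Ω
    · exact (hpos z hz).le
    · exact (hoff z hz).ge
  have hec : Continuous e := by
    have : LipschitzWith 1 e := LipschitzWith.of_le_add fun p q => by linarith [hlip p q]
    exact this.continuous
  have hopenD : ∀ s, IsOpen {z | z ∈ Ω ∧ q z < s} := fun s =>
    hqc.isOpen_inter_preimage hopen isOpen_Iio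
  have hcl : ∀ s < 1, ∀ z ∈ closure {z | z ∈ Ω ∧ q z < s}, z ∈ Ω ∧ q z ≤ s := by
    intro s hs z hz
    -- The lower bound for `e ^ 2` passes to the closure, and `e` vanishes off `Ω`.
    have hzΩ : z ∈ Ω := by
      by_contra hcon
      have : e z₀ ^ 2 * (1 - s) ≤ e z ^ 2 :=
        closure_minimal (t := {z | e z₀ ^ 2 * (1 - s) ≤ e z ^ 2})
          (fun y hy => mem_ofPred.2 (hbound s y hy.1 hy.2))
          (isClosed_le continuous_const (hec.pow 2)) hz
      rw [hoff z hcon] at this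
      nlinarith
    refine ⟨hzΩ, ?_⟩
    by_contra hlt
    have h1 : IsOpen (Ω ∩ q ⁻¹' Ioi s) := hqc.isOpen_inter_preimage hopen isOpen_Ioi
    obtain ⟨y, hy1, hy2⟩ := mem_closure_iff.1 hz _ h1 ⟨hzΩ, not_le.1 hlt⟩
    exact lt_asymm hy1.2 hy2.2
  refine ⟨fun s => {z | z ∈ Ω ∧ q z < s}, ⟨one_pos, fun s _ => hopenD s, ?_, ?_, ?_, ?_⟩,
    ⟨z₀, hz₀, ?_⟩, e z₀ ^ 2, hc, fun s _ z hz => hbound s z hz.1 hz.2⟩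
  · intro s hs
    have h1 : 0 < -Real.log (1 - s) / 2 := by
      have := Real.log_neg (x := 1 - s) (by linarith [hs.2]) (by linarith [hs.1])
      linarith
    have h2 := isConnected_intrinsicDist_lt hopen hconn hlip hpos hoff hle hz₀ h1
    suffices h3 : {z | z ∈ Ω ∧ q z < s} =
        {z | z ∈ Ω ∧ intrinsicDist Ω e z₀ z < -Real.log (1 - s) / 2} from h3 ▸ h2
    ext z
    refine and_congr_right fun _ => ?_
    change 1 - Real.exp (-(2 * r z)) < s ↔ r z < _
    rw [show (1 - Real.exp (-(2 * r z)) < s) ↔ 1 - s < Real.exp (-(2 * r z)) by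
      constructor <;> intro h <;> linarith, ← Real.log_lt_iff_lt_exp (by linarith [hs.2])]
    constructor <;> intro h <;> linarith
  · intro s hs s' hs' hlt z hz
    obtain ⟨h1, h2⟩ := hcl s hs.2 z hz
    exact ⟨h1, h2.trans_lt hlt⟩
  · ext z
    simp only [mem_iUnion, mem_ofPred_eq, exists_prop]
    constructor
    · rintro ⟨s, _, hz, _⟩; exact hz
    · intro hz
      have h1 := hq1 z
      have h0 : 0 ≤ q z := by
        have : Real.exp (-(2 * r z)) ≤ 1 := Real.exp_le_one_iff.2 (by linarith [hr0 z hz])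
        simp only [q]; linarith
      exact ⟨(q z + 1) / 2, ⟨by linarith, by linarith⟩, hz, by linarith⟩
  · refine ⟨e z₀ ^ 2, hc, fun s _ z hz y hy => ?_⟩
    have h1 := hbound s z hz.1 hz.2
    have h2 := hlip z y
    rw [hoff y hy] at h2
    nlinarith [he0 z, hle z]
  · intro z hz hne
    -- Without a local minimum at `z`, the point lies in the closure of its own strict sublevel set,
    -- hence on the frontier at the level `q z`.
    have hlow : ∀ δ > 0, ∃ y ∈ ball z δ, y ∈ Ω ∧ q y < q z := fun δ hδ => by
      obtain ⟨y, h1, h2, h3⟩ := exists_intrinsicDist_lt hopen hconn hlip hpos hoff hle hz₀ hz hne hδ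
      exact ⟨y, h1, h2, hq_lt y z h3⟩
    refine ⟨q z, ⟨⟨?_, hq1 z⟩, ?_⟩, ?_⟩
    · obtain ⟨y, _, hy, hlt⟩ := hlow 1 one_pos
      have : Real.exp (-(2 * r y)) ≤ 1 := Real.exp_le_one_iff.2 (by linarith [hr0 y hy])
      have : 0 ≤ q y := by simp only [q]; linarith
      linarith
    · rw [(hopenD _).frontier_eq]
      refine ⟨Metric.mem_closure_iff.2 fun δ hδ => ?_, fun h => lt_irrefl _ h.2⟩
      obtain ⟨y, h1, h2, h3⟩ := hlow δ hδ
      exact ⟨y, ⟨h2, h3⟩, by rwa [dist_comm]⟩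
    · rintro s ⟨hs, hfr⟩
      rw [(hopenD _).frontier_eq] at hfr
      refine le_antisymm ?_ (hcl s hs.2 z hfr.1).2
      by_contra hlt
      exact hfr.2 ⟨hz, not_le.1 hlt⟩

/-! ### Continuous families of holomorphic functions -/

/-- Functions of `(t, ζ) ∈ ℝ × U`, jointly continuous, and holomorphic in `ζ`. -/
structure IsHolomorphicFamily (W : ℝ → ℂ → ℂ) (U : Set ℂ) : Prop where
  continuousOn : ContinuousOn (fun p : ℝ × ℂ => W p.1 p.2) (univ ×ˢ U)
  differentiableOn : ∀ t, DifferentiableOn ℂ (W t) U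

/-- The derivative in `ζ` of a continuous family of holomorphic functions is jointly continuous. -/
theorem IsHolomorphicFamily.deriv {W : ℝ → ℂ → ℂ} {U : Set ℂ} (hU : IsOpen U)
    (hW : IsHolomorphicFamily W U) : IsHolomorphicFamily (fun t => deriv (W t)) U := by
  refine ⟨?_, fun t => (hW.differentiableOn t).deriv hU⟩
  rintro ⟨t, ζ⟩ ⟨-, hζ⟩
  obtain ⟨r, hr, hrU⟩ := nhds_basis_closedBall.mem_iff.1 (hU.mem_nhds hζ)
  set J : Set ℝ := closedBall t 1
  have hJ : J ∈ 𝓝 t := closedBall_mem_nhds t one_pos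
  have huc : UniformContinuousOn (fun p : ℝ × ℂ => W p.1 p.2) (J ×ˢ closedBall ζ r) :=
    ((isCompact_closedBall t 1).prod (isCompact_closedBall ζ r)).uniformContinuousOn_of_continuous
      (hW.continuousOn.mono (prod_mono (subset_univ _) hrU))
  have h1 : TendstoUniformlyOn W (W t) (𝓝 t) (closedBall ζ r) := by
    have := huc.tendstoUniformlyOn (F := W) (mem_of_mem_nhds hJ)
    rwa [nhdsWithin_eq_nhds.2 hJ] at this
  -- Weierstrass: as `s → t`, locally uniform convergence of `W s` carries over to the derivatives.
  have h2 : TendstoLocallyUniformlyOn (_root_.deriv ∘ W) (_root_.deriv (W t)) (𝓝 t) (ball ζ r) :=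
    (h1.mono ball_subset_closedBall).tendstoLocallyUniformlyOn.deriv
      (Eventually.of_forall fun s => (hW.differentiableOn s).mono
        (ball_subset_closedBall.trans hrU)) isOpen_ball
  have hmem : ball ζ r ∈ 𝓝 ζ := ball_mem_nhds ζ hr
  have hfst : Tendsto (Prod.fst : ℝ × ℂ → ℝ) (𝓝 (t, ζ)) (𝓝 t) := continuousAt_fst
  have hsnd : Tendsto (Prod.snd : ℝ × ℂ → ℂ) (𝓝 (t, ζ)) (𝓝 ζ) := continuousAt_snd
  refine ContinuousAt.continuousWithinAt ?_
  have hcont : ContinuousAt (_root_.deriv (W t)) ζ :=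
    (((hW.differentiableOn t).deriv hU).differentiableAt (hU.mem_nhds hζ)).continuousAt
  refine tendsto_comp_of_locally_uniform_limit (f := _root_.deriv (W t))
    (F := fun p : ℝ × ℂ => _root_.deriv (W p.1)) (g := Prod.snd) hcont hsnd ?_
  intro u hu
  obtain ⟨v, hv, hv'⟩ := h2 u hu ζ (mem_ball_self hr)
  rw [nhdsWithin_eq_nhds.2 hmem] at hv
  exact ⟨v, hv, hfst.eventually hv'⟩

theorem IsHolomorphicFamily.add {V W : ℝ → ℂ → ℂ} {U : Set ℂ}
    (hV : IsHolomorphicFamily V U) (hW : IsHolomorphicFamily W U) :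
    IsHolomorphicFamily (fun t ζ => V t ζ + W t ζ) U :=
  ⟨hV.continuousOn.add hW.continuousOn,
    fun t => (hV.differentiableOn t).add (hW.differentiableOn t)⟩

theorem IsHolomorphicFamily.mul {V W : ℝ → ℂ → ℂ} {U : Set ℂ}
    (hV : IsHolomorphicFamily V U) (hW : IsHolomorphicFamily W U) :
    IsHolomorphicFamily (fun t ζ => V t ζ * W t ζ) U :=
  ⟨hV.continuousOn.mul hW.continuousOn,
    fun t => (hV.differentiableOn t).mul (hW.differentiableOn t)⟩

theorem isHolomorphicFamily_const {f : ℂ → ℂ} {U : Set ℂ} (hf : DifferentiableOn ℂ f U) :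
    IsHolomorphicFamily (fun _ => f) U :=
  ⟨hf.continuousOn.comp continuousOn_snd fun _ hp => hp.2, fun _ => hf⟩

theorem IsHolomorphicFamily.continuous_left {W : ℝ → ℂ → ℂ} {U : Set ℂ}
    (hW : IsHolomorphicFamily W U) {ζ : ℂ} (hζ : ζ ∈ U) : Continuous fun t => W t ζ :=
  continuousOn_univ.1 <| hW.continuousOn.comp (f := fun t : ℝ => (t, ζ))
    (by fun_prop) fun _ _ => ⟨mem_univ _, hζ⟩

theorem IsHolomorphicFamily.exists_bound {W : ℝ → ℂ → ℂ} {U : Set ℂ}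
    (hW : IsHolomorphicFamily W U) {J : Set ℝ} (hJ : IsCompact J) {K : Set ℂ} (hK : IsCompact K)
    (hKU : K ⊆ U) : ∃ C > 0, ∀ t ∈ J, ∀ ζ ∈ K, ‖W t ζ‖ ≤ C := by
  obtain ⟨C, hC⟩ := (hJ.prod hK).exists_bound_of_continuousOn
    (hW.continuousOn.mono (prod_mono (subset_univ _) hKU))
  exact ⟨max C 1, by positivity, fun t ht ζ hζ => (hC (t, ζ) ⟨ht, hζ⟩).trans (le_max_left _ _)⟩

theorem IsHolomorphicFamily.integral {W : ℝ → ℂ → ℂ} {U : Set ℂ} (hU : IsOpen U)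
    (hW : IsHolomorphicFamily W U) :
    IsHolomorphicFamily (fun t ζ => ∫ τ in (0 : ℝ)..t, W τ ζ) U := by
  constructor
  · rw [continuousOn_iff_continuous_domRestrict]
    refine intervalIntegral.continuous_parametric_intervalIntegral_of_continuous
      (f := fun (p : (univ ×ˢ U : Set (ℝ × ℂ))) τ => W τ p.1.2) (s := fun p => p.1.1) ?_ ?_
    · refine hW.continuousOn.comp_continuous (f := fun q : (univ ×ˢ U : Set (ℝ × ℂ)) × ℝ =>
        (q.2, q.1.1.2)) (by fun_prop) fun q => ⟨mem_univ _, q.1.2.2⟩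
    · fun_prop
  · intro t ζ hζ
    obtain ⟨r, hr, hrU⟩ := nhds_basis_closedBall.mem_iff.1 (hU.mem_nhds hζ)
    have hW' := hW.deriv hU
    obtain ⟨C, -, hC⟩ := hW'.exists_bound (isCompact_uIcc (a := 0) (b := t))
      (isCompact_closedBall ζ r) hrU
    refine (intervalIntegral.hasDerivAt_integral_of_dominated_loc_of_deriv_le
      (F := fun η τ => W τ η) (F' := fun η τ => _root_.deriv (W τ) η) (bound := fun _ => C)
      (closedBall_mem_nhds ζ hr) ?_ ((hW.continuous_left hζ).intervalIntegrable _ _)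
      (hW'.continuous_left hζ).aestronglyMeasurable ?_ intervalIntegrable_const
      ?_).2.differentiableAt.differentiableWithinAt
    · filter_upwards [hU.mem_nhds hζ] with η hη
      exact (hW.continuous_left hη).aestronglyMeasurable
    · exact Eventually.of_forall fun τ hτ η hη => hC τ (uIoc_subset_uIcc hτ) η hη
    · exact Eventually.of_forall fun τ _ η hη =>
        ((hW.differentiableOn τ).differentiableAt (hU.mem_nhds (hrU hη))).hasDerivAt

theorem IsHolomorphicFamily.hasDerivAt_integral {W : ℝ → ℂ → ℂ} {U : Set ℂ}
    (hW : IsHolomorphicFamily W U) {ζ : ℂ} (hζ : ζ ∈ U) (t : ℝ) :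
    HasDerivAt (fun r => ∫ τ in (0 : ℝ)..r, W τ ζ) (W t ζ) t :=
  intervalIntegral.integral_hasDerivAt_right ((hW.continuous_left hζ).intervalIntegrable _ _)
    (hW.continuous_left hζ).aestronglyMeasurable.stronglyMeasurableAtFilter
    (hW.continuous_left hζ).continuousAt

/-! ### Picard iteration for `∂ₜ W = a W' + e W + g` in a cone -/

/-- The successive corrections in the Picard iteration for `∂ₜ W = a W' + e W + g`,
`W 0 = ρ`. -/
def picardTerm (a e g : ℝ → ℂ → ℂ) (ρ : ℂ → ℂ) : ℕ → ℝ → ℂ → ℂ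
  | 0 => fun t ζ => ρ ζ + ∫ τ in (0 : ℝ)..t, g τ ζ
  | n + 1 => fun t ζ => ∫ τ in (0 : ℝ)..t,
      (a τ ζ * deriv (picardTerm a e g ρ n τ) ζ + e τ ζ * picardTerm a e g ρ n τ ζ)

section Picard

variable {a e g : ℝ → ℂ → ℂ} {ρ : ℂ → ℂ} {U : Set ℂ}

theorem isHolomorphicFamily_picardTerm (hU : IsOpen U) (ha : IsHolomorphicFamily a U)
    (he : IsHolomorphicFamily e U) (hg : IsHolomorphicFamily g U) (hρ : DifferentiableOn ℂ ρ U)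
    (n : ℕ) : IsHolomorphicFamily (picardTerm a e g ρ n) U := by
  induction n with
  | zero => exact (isHolomorphicFamily_const hρ).add (hg.integral hU)
  | succ n ih => exact ((ha.mul (ih.deriv hU)).add (he.mul ih)).integral hU

/-- A norm bound in `t` of both signs from a bound of the derivative. -/
theorem norm_le_of_norm_deriv_le_abs {f f' : ℝ → ℂ} {t : ℝ} (hf : ∀ s, HasDerivAt f (f' s) s)
    {B B' : ℝ → ℝ} (h0 : ‖f 0‖ ≤ B 0) (hB : ∀ s ∈ Icc 0 |t|, HasDerivAt B (B' s) s)
    (hbound : ∀ s, |s| ≤ |t| → ‖f' s‖ ≤ B' |s|) : ‖f t‖ ≤ B |t| := by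
  have hBc : ContinuousOn B (Icc 0 |t|) := fun s hs => (hB s hs).continuousAt.continuousWithinAt
  have hB' : ∀ s ∈ Ico 0 |t|, HasDerivWithinAt B (B' s) (Ici s) s := fun s hs =>
    (hB s (Ico_subset_Icc_self hs)).hasDerivWithinAt
  rcases le_total 0 t with ht | ht
  · have h := image_norm_le_of_norm_deriv_right_le_deriv_boundary' (a := 0) (b := |t|)
      (fun s _ => (hf s).continuousAt.continuousWithinAt)
      (fun s _ => (hf s).hasDerivWithinAt) h0 hBc hB' (fun s hs => ?_)
      (right_mem_Icc.2 (abs_nonneg t))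
    · rwa [abs_of_nonneg ht] at h ⊢
    · have := hbound s (by rw [abs_of_nonneg hs.1]; exact hs.2.le)
      rwa [abs_of_nonneg hs.1] at this
  · have hf' : ∀ s, HasDerivAt (fun s => f (-s)) (-f' (-s)) s := fun s => by
      have h : HasDerivAt (fun s => f (-s)) ((-1 : ℝ) • f' (-s)) s :=
        (hf (-s)).scomp s (hasDerivAt_neg s)
      rwa [neg_one_smul] at h
    have h := image_norm_le_of_norm_deriv_right_le_deriv_boundary' (a := 0) (b := |t|)
      (fun s _ => (hf' s).continuousAt.continuousWithinAt)
      (fun s _ => (hf' s).hasDerivWithinAt) (by simpa using h0) hBc hB' (fun s hs => ?_)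
      (right_mem_Icc.2 (abs_nonneg t))
    · simpa [abs_of_nonpos ht] using h
    · have := hbound (-s) (by rw [abs_neg, abs_of_nonneg hs.1]; exact hs.2.le)
      rwa [abs_neg, abs_of_nonneg hs.1, ← norm_neg] at this

/-- Cauchy's estimate on the circle of radius `d / 2`, where `d = R - dist ζ z₀ - κ s`. On that
circle the assumed bound is at most `C / (d / 2)`, whence the factor 4 and the second power. -/
theorem norm_deriv_le_of_bound {f : ℂ → ℂ} {z₀ ζ : ℂ} {R κ s C : ℝ} (hC : 0 ≤ C)
    (hf : DifferentiableOn ℂ f (closedBall z₀ R)) (hs : 0 ≤ κ * s)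
    (h : ∀ η, κ * s < R - dist η z₀ → ‖f η‖ ≤ C / (R - dist η z₀ - κ * s))
    (hζ : κ * s < R - dist ζ z₀) :
    ‖deriv f ζ‖ ≤ 4 * C / (R - dist ζ z₀ - κ * s) ^ 2 := by
  set d := R - dist ζ z₀ - κ * s
  have hd : 0 < d := by simp only [d]; linarith
  have hsub : closedBall ζ (d / 2) ⊆ closedBall z₀ R := by
    intro η hη
    have h1 := mem_closedBall.1 hη
    have h2 := dist_triangle η ζ z₀
    rw [mem_closedBall]
    simp only [d] at h1
    linarith
  have h1 := Complex.norm_deriv_le_of_forall_mem_sphere_norm_le (c := ζ) (R := d / 2)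
    (C := C / (d / 2)) (f := f) (by linarith) (hf.diffContOnCl_ball hsub) (fun η hη => ?_)
  · refine h1.trans (le_of_eq ?_)
    field_simp
    ring
  · have h2 : dist η ζ = d / 2 := hη
    have h3 := dist_triangle η ζ z₀
    have h4 : d / 2 ≤ R - dist η z₀ - κ * s := by simp only [d] at *; linarith
    refine (h η (by linarith)).trans ?_
    exact div_le_div_of_nonneg_left hC (by linarith) h4

/-- The majorant for the induction: in its derivative the `κ` term has the second power needed for
`a W'`, and the `L` term absorbs `e W`. -/
theorem hasDerivAt_exp_div {C L κ δ s : ℝ} (h : κ * s < δ) :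
    HasDerivAt (fun s => C * Real.exp (L * s) / (δ - κ * s))
      (C * Real.exp (L * s) * (L / (δ - κ * s) + κ / (δ - κ * s) ^ 2)) s := by
  have hne : δ - κ * s ≠ 0 := by linarith
  have h1 : HasDerivAt (fun s => C * Real.exp (L * s)) (C * (Real.exp (L * s) * (L * 1))) s :=
    (((hasDerivAt_id s).const_mul L).exp).const_mul C
  have h2 : HasDerivAt (fun s => δ - κ * s) (-(κ * 1)) s :=
    ((hasDerivAt_id s).const_mul κ).const_sub δ
  refine (h1.div h2 hne).congr_deriv ?_
  field_simp
  ring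

/-- The Picard corrections decay geometrically in a cone over a ball. -/
theorem exists_norm_picardTerm_le (hU : IsOpen U) (ha : IsHolomorphicFamily a U)
    (he : IsHolomorphicFamily e U) (hg : IsHolomorphicFamily g U) (hρ : DifferentiableOn ℂ ρ U)
    {z₀ : ℂ} {R K N : ℝ} (hR : closedBall z₀ R ⊆ U) (hR0 : 0 < R) (hK0 : 0 < K) (hN0 : 0 ≤ N)
    (hK : ∀ t, ∀ ζ ∈ closedBall z₀ R, ‖a t ζ‖ ≤ K)
    (hN : ∀ t, ∀ ζ ∈ closedBall z₀ R, ‖e t ζ‖ ≤ N) :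
    ∃ C > 0, ∀ n t ζ, 8 * K * |t| < R - dist ζ z₀ →
      ‖picardTerm a e g ρ n t ζ‖ ≤
        C * (1 / 2) ^ n * Real.exp (2 * N * |t|) / (R - dist ζ z₀ - 8 * K * |t|) := by
  obtain ⟨C, hC0, hC⟩ := (isHolomorphicFamily_picardTerm hU ha he hg hρ 0).exists_bound
    (isCompact_Icc (a := -(R / (8 * K))) (b := R / (8 * K))) (isCompact_closedBall z₀ R) hR
  have hin : ∀ {t : ℝ} {ζ : ℂ}, 8 * K * |t| < R - dist ζ z₀ → ζ ∈ closedBall z₀ R := by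
    intro t ζ h
    have : 0 ≤ 8 * K * |t| := by positivity
    rw [mem_closedBall]; linarith
  -- The denominator never exceeds `R`, so the factor `R` turns the uniform bound `C` of the zeroth
  -- term into one of the required shape.
  refine ⟨C * R, by positivity, fun n => ?_⟩
  induction n with
  | zero =>
    intro t ζ h
    have ht : |t| ≤ R / (8 * K) := by
      rw [le_div_iff₀ (by positivity)]
      linarith [dist_nonneg (x := ζ) (y := z₀)]
    refine (hC t (abs_le.1 ht) ζ (hin h)).trans ?_
    rw [le_div_iff₀ (by linarith), pow_zero, mul_one]
    have h1 : 1 ≤ Real.exp (2 * N * |t|) := Real.one_le_exp (by positivity)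
    have h2 : R - dist ζ z₀ - 8 * K * |t| ≤ R := by
      have : 0 ≤ 8 * K * |t| := by positivity
      linarith [dist_nonneg (x := ζ) (y := z₀)]
    calc C * (R - dist ζ z₀ - 8 * K * |t|) ≤ C * R := by gcongr
      _ ≤ C * R * Real.exp (2 * N * |t|) := le_mul_of_one_le_right (by positivity) h1
  | succ n ih =>
    intro t ζ h
    have hfam := isHolomorphicFamily_picardTerm hU ha he hg hρ n
    have hζ := hin h
    refine norm_le_of_norm_deriv_le_abs (f := fun t => picardTerm a e g ρ (n + 1) t ζ)
      (B := fun s => C * R * (1 / 2) ^ (n + 1) * Real.exp (2 * N * s) /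
        (R - dist ζ z₀ - 8 * K * s))
      (fun s => ((ha.mul (hfam.deriv hU)).add (he.mul hfam)).hasDerivAt_integral (hR hζ) s)
      ?_ (fun s hs => hasDerivAt_exp_div ?_) ?_
    · have : 0 < R - dist ζ z₀ := lt_of_le_of_lt (by positivity) h
      simp only [picardTerm, intervalIntegral.integral_same, norm_zero]
      simp only [mul_zero, sub_zero]
      positivity
    · refine lt_of_le_of_lt ?_ h
      have := hs.2
      gcongr
    · intro s hs
      have hsd : 8 * K * |s| < R - dist ζ z₀ := lt_of_le_of_lt (by gcongr) h
      have hd : 0 < R - dist ζ z₀ - 8 * K * |s| := by linarith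
      have h1 := norm_deriv_le_of_bound (f := picardTerm a e g ρ n s) (z₀ := z₀) (ζ := ζ)
        (R := R) (κ := 8 * K) (s := |s|)
        (C := C * R * (1 / 2) ^ n * Real.exp (2 * N * |s|)) (by positivity)
        ((hfam.differentiableOn s).mono hR) (by positivity) (fun η hη => ih s η hη) hsd
      have h2 := ih s ζ hsd
      set d := R - dist ζ z₀ - 8 * K * |s|
      set M := C * R * (1 / 2) ^ n * Real.exp (2 * N * |s|)
      calc ‖a s ζ * deriv (picardTerm a e g ρ n s) ζ + e s ζ * picardTerm a e g ρ n s ζ‖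
          ≤ ‖a s ζ‖ * ‖deriv (picardTerm a e g ρ n s) ζ‖ +
              ‖e s ζ‖ * ‖picardTerm a e g ρ n s ζ‖ := by
            rw [← norm_mul, ← norm_mul]; exact norm_add_le _ _
        -- With slope `8 K` and rate `2 N` this is exactly half of the derivative of the majorant of
        -- step `n`, which is the gain of `1 / 2` in each step.
        _ ≤ K * (4 * M / d ^ 2) + N * (M / d) := by
            have := hK s ζ hζ
            have := hN s ζ hζ
            gcongr
        _ = C * R * (1 / 2) ^ (n + 1) * Real.exp (2 * N * |s|) *
              (2 * N / d + 8 * K / d ^ 2) := by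
            simp only [M]; rw [pow_succ]; ring

end Picard

/-- Local existence of `∂ₜ W = a W' + e W + g`, `W 0 = ρ`, with one function `W` that is a
solution near every `(t₀, z₀)` such that `8 K |t₀| < R`, where `K` bounds `a` on a closed ball of
radius `R` about `z₀` inside `U`. -/
theorem exists_solution {a e g : ℝ → ℂ → ℂ} {ρ : ℂ → ℂ} {U : Set ℂ} (hU : IsOpen U)
    (ha : IsHolomorphicFamily a U) (he : IsHolomorphicFamily e U)
    (hg : IsHolomorphicFamily g U) (hρ : DifferentiableOn ℂ ρ U)
    (heb : ∀ K ⊆ U, IsCompact K → ∃ N, ∀ t, ∀ ζ ∈ K, ‖e t ζ‖ ≤ N) :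
    ∃ W : ℝ → ℂ → ℂ, (∀ ζ, W 0 ζ = ρ ζ) ∧
      ∀ z₀ R K t₀, closedBall z₀ R ⊆ U → 0 < R → 0 < K →
        (∀ t, ∀ ζ ∈ closedBall z₀ R, ‖a t ζ‖ ≤ K) → 8 * K * |t₀| < R →
        ContinuousAt (fun p : ℝ × ℂ => W p.1 p.2) (t₀, z₀) ∧
        DifferentiableAt ℂ (W t₀) z₀ ∧
        HasDerivAt (fun t => W t z₀)
          (a t₀ z₀ * deriv (W t₀) z₀ + e t₀ z₀ * W t₀ z₀ + g t₀ z₀) t₀ := by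
  set V := picardTerm a e g ρ
  -- The sum is `0` by default where it diverges. At time `0` only the zeroth term is nonzero, so
  -- the initial value holds everywhere.
  refine ⟨fun t ζ => ∑' n, V n t ζ, fun ζ => ?_, ?_⟩
  · have h : ∀ n, n ≠ 0 → V n 0 ζ = 0 := fun n hn => by
      obtain ⟨m, rfl⟩ := Nat.exists_eq_succ_of_ne_zero hn
      simp [V, picardTerm]
    simp only
    rw [tsum_eq_single 0 h]
    simp [V, picardTerm]
  intro z₀ R K t₀ hR hR0 hK0 hK ht₀
  obtain ⟨N', hN'⟩ := heb _ hR (isCompact_closedBall z₀ R)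
  obtain ⟨N, hN0, hN⟩ : ∃ N, 0 ≤ N ∧ ∀ t, ∀ ζ ∈ closedBall z₀ R, ‖e t ζ‖ ≤ N :=
    ⟨max N' 0, le_max_right _ _, fun t ζ hζ => (hN' t ζ hζ).trans (le_max_left _ _)⟩
  obtain ⟨C, hC0, hC⟩ := exists_norm_picardTerm_le hU ha he hg hρ hR hR0 hK0 hN0 hK hN
  have hV : ∀ n, IsHolomorphicFamily (V n) U := isHolomorphicFamily_picardTerm hU ha he hg hρ
  -- The margin `σ` is spent by quarters: one on enlarging `|t₀|` to `T₁`, one on the ball about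
  -- `z₀`. The distance to the cone stays at least `σ / 2` on `J ×ˢ B`.
  set σ := R - 8 * K * |t₀|
  have hσ : 0 < σ := by simp only [σ]; linarith
  set T₁ := |t₀| + σ / (32 * K)
  have hT₁ : 8 * K * T₁ = 8 * K * |t₀| + σ / 4 := by
    simp only [T₁]; field_simp; ring
  set J : Set ℝ := Ioo (-T₁) T₁
  have habs : ∀ {t}, t ∈ J → |t| < T₁ := fun ht => abs_lt.2 ht
  have hT₁pos : |t₀| < T₁ := by
    have : 0 < σ / (32 * K) := by positivity
    simp only [T₁]; linarith
  have hT₁0 : 0 < T₁ := (abs_nonneg t₀).trans_lt hT₁pos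
  have ht₀J : t₀ ∈ J := abs_lt.1 hT₁pos
  set B : Set ℂ := ball z₀ (σ / 4)
  have hz₀B : z₀ ∈ B := mem_ball_self (by positivity)
  have hlow : ∀ t ∈ J, ∀ ζ ∈ B, σ / 2 ≤ R - dist ζ z₀ - 8 * K * |t| := by
    intro t ht ζ hζ
    have h1 : 8 * K * |t| ≤ 8 * K * T₁ := by have := habs ht; gcongr
    have h2 := mem_ball.1 hζ
    simp only [σ] at *
    linarith
  have hσR : σ ≤ R := by
    have : 0 ≤ 8 * K * |t₀| := by positivity
    simp only [σ]; linarith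
  have hBR : B ⊆ closedBall z₀ R :=
    ball_subset_closedBall.trans (closedBall_subset_closedBall (by linarith))
  have hBU : B ⊆ U := hBR.trans hR
  set M := C * Real.exp (2 * N * T₁)
  have hM0 : 0 < M := by positivity
  have hexp : ∀ n, ∀ t ∈ J, C * (1 / 2) ^ n * Real.exp (2 * N * |t|) ≤ M * (1 / 2) ^ n := by
    intro n t ht
    have : Real.exp (2 * N * |t|) ≤ Real.exp (2 * N * T₁) := by
      have := habs ht; gcongr
    calc C * (1 / 2) ^ n * Real.exp (2 * N * |t|) ≤ C * (1 / 2) ^ n * Real.exp (2 * N * T₁) := by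
          gcongr
      _ = M * (1 / 2) ^ n := by simp only [M]; ring
  have hbV : ∀ n, ∀ t ∈ J, ∀ ζ ∈ B, ‖V n t ζ‖ ≤ M / (σ / 2) * (1 / 2) ^ n := by
    intro n t ht ζ hζ
    have h1 := hlow t ht ζ hζ
    refine (hC n t ζ (by linarith)).trans ?_
    calc _ ≤ M * (1 / 2) ^ n / (σ / 2) := by
          refine div_le_div₀ (by positivity) (hexp n t ht) (by positivity) h1
      _ = M / (σ / 2) * (1 / 2) ^ n := by ring
  have hbV' : ∀ n, ∀ t ∈ J, ‖deriv (V n t) z₀‖ ≤ 4 * M / (σ / 2) ^ 2 * (1 / 2) ^ n := by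
    intro n t ht
    have h1 := hlow t ht z₀ hz₀B
    refine (norm_deriv_le_of_bound (C := C * (1 / 2) ^ n * Real.exp (2 * N * |t|))
      (κ := 8 * K) (s := |t|) (z₀ := z₀) (R := R) (by positivity)
      (((hV n).differentiableOn t).mono hR) (by positivity) (fun η hη => hC n t η hη)
      (by linarith)).trans ?_
    have h2 := hexp n t ht
    calc _ ≤ 4 * (M * (1 / 2) ^ n) / (σ / 2) ^ 2 := by
          refine div_le_div₀ (by positivity) (by linarith) (by positivity) ?_
          exact pow_le_pow_left₀ (by positivity) h1 2
      _ = 4 * M / (σ / 2) ^ 2 * (1 / 2) ^ n := by ring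
  have hgeo : Summable fun n : ℕ => ((1 : ℝ) / 2) ^ n := summable_geometric_two
  have hsum := hgeo.mul_left (M / (σ / 2))
  have hsum' := hgeo.mul_left (4 * M / (σ / 2) ^ 2)
  refine ⟨?_, ?_, ?_⟩
  · have h := continuousOn_tsum (f := fun n (p : ℝ × ℂ) => V n p.1 p.2) (s := J ×ˢ B)
      (fun n => (hV n).continuousOn.mono (prod_mono (subset_univ _) hBU)) hsum
      (fun n p hp => hbV n p.1 hp.1 p.2 hp.2)
    exact h.continuousAt ((isOpen_Ioo.prod isOpen_ball).mem_nhds ⟨ht₀J, hz₀B⟩)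
  · exact (Complex.differentiableOn_tsum_of_summable_norm hsum
      (fun n => ((hV n).differentiableOn t₀).mono hBU) isOpen_ball
      (fun n ζ hζ => hbV n t₀ ht₀J ζ hζ)).differentiableAt (isOpen_ball.mem_nhds hz₀B)
  · have hz₀R : z₀ ∈ closedBall z₀ R := mem_closedBall_self hR0.le
    have hz₀U : z₀ ∈ U := hR hz₀R
    obtain ⟨G, hG0, hG⟩ := hg.exists_bound (isCompact_Icc (a := -T₁) (b := T₁))
      (isCompact_singleton (x := z₀)) (singleton_subset_iff.2 hz₀U)
    set V' : ℕ → ℝ → ℂ := fun n t => Nat.casesOn n (g t z₀)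
      fun m => a t z₀ * deriv (V m t) z₀ + e t z₀ * V m t z₀
    have hd : ∀ n, ∀ t ∈ J, HasDerivAt (fun t => V n t z₀) (V' n t) t := by
      rintro (_ | n) t -
      · exact (hg.hasDerivAt_integral hz₀U t).const_add _
      · exact ((ha.mul ((hV n).deriv hU)).add (he.mul (hV n))).hasDerivAt_integral hz₀U t
    set u : ℕ → ℝ := fun n => Nat.casesOn n G
      fun m => K * (4 * M / (σ / 2) ^ 2 * (1 / 2) ^ m) + N * (M / (σ / 2) * (1 / 2) ^ m)
    have hu : Summable u :=
      (summable_nat_add_iff 1).1 ((hsum'.mul_left K).add (hsum.mul_left N))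
    have hb : ∀ n, ∀ t ∈ J, ‖V' n t‖ ≤ u n := by
      rintro (_ | n) t ht
      · exact hG t (Ioo_subset_Icc_self ht) z₀ rfl
      · refine (norm_add_le _ _).trans ?_
        rw [norm_mul, norm_mul]
        have h1 := hK t z₀ hz₀R
        have h2 := hN t z₀ hz₀R
        have h3 := hbV n t ht z₀ hz₀B
        have h4 := hbV' n t ht
        exact add_le_add (mul_le_mul h1 h4 (norm_nonneg _) hK0.le)
          (mul_le_mul h2 h3 (norm_nonneg _) hN0)
    have hs0 : ∀ t ∈ J, Summable fun n => V n t z₀ := fun t ht =>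
      Summable.of_norm_bounded hsum fun n => hbV n t ht z₀ hz₀B
    have h := hasDerivAt_tsum_of_isPreconnected hu isOpen_Ioo isPreconnected_Ioo hd hb ht₀J
      (hs0 t₀ ht₀J) ht₀J
    refine h.congr_deriv ?_
    have h1 : HasSum (fun n => deriv (V n t₀) z₀) (deriv (fun ζ => ∑' n, V n t₀ ζ) z₀) :=
      Complex.hasSum_deriv_of_summable_norm hsum
        (fun n => ((hV n).differentiableOn t₀).mono hBU) isOpen_ball
        (fun n ζ hζ => hbV n t₀ ht₀J ζ hζ) hz₀B
    have h2 := (h1.mul_left (a t₀ z₀)).add ((hs0 t₀ ht₀J).hasSum.mul_left (e t₀ z₀))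
    have h3 : HasSum (fun n => V' (n + 1) t₀) _ := h2
    -- The shift by one separates `g`, the time derivative of the zeroth term, from the `a V' + e V`
    -- of the others.
    rw [hasSum_nat_add_iff (f := fun n => V' n t₀) 1] at h3
    rw [h3.tsum_eq]
    simp [V']

/-! ### Reduction to ordinary complex analysis -/

/-- The map `x + i y ↦ x + l y` into the complex numbers. -/
def toComplex {α β : ℝ} (l : ℂ) (w : Num α β) : ℂ := w.re + w.im * l

/-- The inverse of `toComplex`. -/
def ofComplex {α β : ℝ} (l c : ℂ) : Num α β := ⟨c.re - c.im / l.im * l.re, c.im / l.im⟩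

section Embedding

variable {α β : ℝ} {l : ℂ}

theorem toComplex_add (v w : Num α β) :
    toComplex l (v + w) = toComplex l v + toComplex l w := by
  simp [toComplex]; ring

theorem toComplex_mul (hl : l * l = -α - β * l) (v w : Num α β) :
    toComplex l (v * w) = toComplex l v * toComplex l w := by
  simp only [toComplex, QuadraticAlgebra.re_mul, QuadraticAlgebra.im_mul]
  push_cast
  linear_combination (-(v.im : ℂ) * w.im) * hl

theorem toComplex_smul (r : ℝ) (w : Num α β) : toComplex l (r • w) = r * toComplex l w := by
  simp [toComplex]; ring

theorem toComplex_ofComplex (him : l.im ≠ 0) (c : ℂ) :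
    toComplex l (ofComplex l c : Num α β) = c := by
  apply Complex.ext <;> simp [toComplex, ofComplex, him]

theorem ofComplex_toComplex (him : l.im ≠ 0) (w : Num α β) :
    ofComplex l (toComplex l w) = w := by
  ext <;> simp [toComplex, ofComplex, him]

theorem toComplex_injective (him : l.im ≠ 0) :
    Function.Injective (toComplex l : Num α β → ℂ) :=
  Function.LeftInverse.injective (ofComplex_toComplex him)

/-- The real-linear coordinate `x - y / l`, which is holomorphic for the operator `∂ₓ + l ∂_y`. -/
def chart (l : ℂ) (him : l.im ≠ 0) : (ℝ × ℝ) ≃L[ℝ] ℂ :=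
  have h : (-l⁻¹).im ≠ 0 := by
    have : Complex.normSq l ≠ 0 := by
      rw [Ne, Complex.normSq_eq_zero]; rintro rfl; exact him rfl
    rw [Complex.neg_im, Complex.inv_im, neg_div, neg_neg]
    exact div_ne_zero him this
  ContinuousLinearEquiv.equivOfInverse
    (Complex.ofRealCLM.comp (ContinuousLinearMap.fst ℝ ℝ ℝ) +
      (ContinuousLinearMap.snd ℝ ℝ ℝ).smulRight (-l⁻¹))
    ((Complex.reCLM - ((-l⁻¹).re / (-l⁻¹).im) • Complex.imCLM).prod
      ((1 / (-l⁻¹).im) • Complex.imCLM))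
    (fun z => by
      generalize -l⁻¹ = m at h
      ext <;> simp
      · field_simp; ring
      · field_simp)
    (fun c => by
      generalize -l⁻¹ = m at h
      apply Complex.ext <;> simp
      · field_simp; ring
      · field_simp)

theorem chart_apply (him : l.im ≠ 0) (z : ℝ × ℝ) : chart l him z = z.1 - z.2 * l⁻¹ := by
  change (z.1 : ℂ) + z.2 • (-l⁻¹) = _
  rw [Complex.real_smul]; ring

/-- A function `w` with values in `Num α β`, as a complex function in the coordinate `chart`. -/
def toComplexFun (l : ℂ) (him : l.im ≠ 0) (w : ℝ × ℝ → Num α β) (ζ : ℂ) : ℂ :=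
  toComplex l (w ((chart l him).symm ζ))

theorem toComplexFun_chart (him : l.im ≠ 0) (w : ℝ × ℝ → Num α β) (z : ℝ × ℝ) :
    toComplexFun l him w (chart l him z) = toComplex l (w z) := by
  simp [toComplexFun]

/-- The pair of `x`-derivatives, as a number. -/
def numX (w : ℝ × ℝ → Num α β) (z : ℝ × ℝ) : Num α β :=
  ⟨partialX (fun p => (w p).re) z, partialX (fun p => (w p).im) z⟩

/-- The pair of `y`-derivatives, as a number. -/
def numY (w : ℝ × ℝ → Num α β) (z : ℝ × ℝ) : Num α β :=
  ⟨partialY (fun p => (w p).re) z, partialY (fun p => (w p).im) z⟩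

theorem toComplex_dbar (hl : l * l = -α - β * l) (w : ℝ × ℝ → Num α β) (z : ℝ × ℝ) :
    toComplex l (dbar w z) = 1 / 2 * (toComplex l (numX w z) + l * toComplex l (numY w z)) := by
  change toComplex l ((1 / 2 : ℝ) • (numX w z + (⟨0, 1⟩ : Num α β) * numY w z)) = _
  rw [toComplex_smul, toComplex_add, toComplex_mul hl]
  simp [toComplex]

theorem dbar_eq_zero_iff (hl : l * l = -α - β * l) (him : l.im ≠ 0) (w : ℝ × ℝ → Num α β)
    (z : ℝ × ℝ) : dbar w z = 0 ↔ toComplex l (numY w z) = -l⁻¹ * toComplex l (numX w z) := by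
  have hl0 : l ≠ 0 := by rintro rfl; exact him rfl
  have h0 : toComplex l (0 : Num α β) = 0 := by simp [toComplex]
  rw [← (toComplex_injective (α := α) (β := β) him).eq_iff, h0, toComplex_dbar hl]
  constructor
  · intro h
    field_simp
    linear_combination 2 * h
  · intro h
    rw [h]
    field_simp
    ring

/-- By the Cauchy-Riemann equation `∂_y w = -l⁻¹ ∂ₓ w`, so the real differential sends `(x, y)` to
`∂ₓ w` times `x - y / l`; it is complex linear in the chart. -/
theorem hasDerivAt_toComplexFun (hl : l * l = -α - β * l) (him : l.im ≠ 0)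
    {w : ℝ × ℝ → Num α β} {z : ℝ × ℝ} (hu : DifferentiableAt ℝ (fun p => (w p).re) z)
    (hv : DifferentiableAt ℝ (fun p => (w p).im) z) (hd : dbar w z = 0) :
    HasDerivAt (toComplexFun l him w) (toComplex l (numX w z)) (chart l him z) := by
  rw [dbar_eq_zero_iff hl him] at hd
  have h1 : HasFDerivAt (fun p => toComplex l (w p))
      (Complex.ofRealCLM.comp (fderiv ℝ (fun p => (w p).re) z) +
        (fderiv ℝ (fun p => (w p).im) z).smulRight l) z := by
    refine ((Complex.ofRealCLM.hasFDerivAt.comp z hu.hasFDerivAt).add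
      (hv.hasFDerivAt.smul_const l)).congr_of_eventuallyEq (Filter.Eventually.of_forall fun p => ?_)
    simp [toComplex]
  have h2 : HasFDerivAt (toComplexFun l him w) _ (chart l him z) :=
    HasFDerivAt.comp (chart l him z) (g := fun p => toComplex l (w p))
      (by rw [ContinuousLinearEquiv.symm_apply_apply]; exact h1)
      (chart l him).symm.hasFDerivAt
  refine HasFDerivAt.hasDerivAt (f' := ContinuousLinearMap.toSpanSingleton ℂ
    (toComplex l (numX w z))) ?_ |>.congr_deriv (by simp)
  refine hasFDerivAt_of_restrictScalars ℝ h2 ?_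
  ext1 c
  obtain ⟨⟨x, y⟩, rfl⟩ := (chart l him).surjective c
  have hsplit : ∀ L : ℝ × ℝ →L[ℝ] ℝ, L (x, y) = x * L (1, 0) + y * L (0, 1) := fun L => by
    have : ((x, y) : ℝ × ℝ) = x • (1, 0) + y • (0, 1) := by simp
    rw [this, map_add, map_smul, map_smul]; rfl
  simp only [ContinuousLinearMap.coe_restrictScalars', ContinuousLinearMap.comp_apply,
    add_apply, ContinuousLinearEquiv.coe_coe, ContinuousLinearEquiv.symm_apply_apply,
    ContinuousLinearMap.smulRight_apply, ContinuousLinearMap.toSpanSingleton_apply, Complex.ofRealCLM_apply, hsplit,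
    Complex.real_smul, smul_eq_mul]
  rw [chart_apply]
  simp only [toComplex, numX, numY, partialX, partialY] at hd ⊢
  push_cast
  linear_combination -(y : ℂ) * hd

theorem of_hasDerivAt_toComplexFun (hl : l * l = -α - β * l) (him : l.im ≠ 0)
    {w : ℝ × ℝ → Num α β} {z : ℝ × ℝ} {d : ℂ}
    (h : HasDerivAt (toComplexFun l him w) d (chart l him z)) :
    DifferentiableAt ℝ (fun p => (w p).re) z ∧ DifferentiableAt ℝ (fun p => (w p).im) z ∧
      toComplex l (numX w z) = d ∧ toComplex l (numY w z) = -l⁻¹ * d ∧ dbar w z = 0 := by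
  have h1 := (h.hasFDerivAt.restrictScalars ℝ).comp z (chart l him).hasFDerivAt
  have him' : HasFDerivAt (fun p => (w p).im) _ z :=
    ((((1 / l.im) • Complex.imCLM).hasFDerivAt).comp z h1).congr_of_eventuallyEq
      (Filter.Eventually.of_forall fun p => by
        have := (ofComplex_toComplex him (w p)).symm
        generalize hc : toComplex l (w p) = c at this
        beta_reduce
        rw [this]
        simp [ofComplex, toComplexFun_chart, div_eq_inv_mul, hc])
  have hre' : HasFDerivAt (fun p => (w p).re) _ z :=
    (((Complex.reCLM - (l.re / l.im) • Complex.imCLM).hasFDerivAt).comp z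
      h1).congr_of_eventuallyEq
      (Filter.Eventually.of_forall fun p => by
        have := (ofComplex_toComplex him (w p)).symm
        generalize hc : toComplex l (w p) = c at this
        beta_reduce
        rw [this]
        simp [ofComplex, toComplexFun_chart, hc]
        ring)
  have hX : numX w z = ofComplex l d := by
    ext
    · simp [numX, partialX, hre'.fderiv, ofComplex, chart_apply]; ring
    · simp [numX, partialX, him'.fderiv, ofComplex, chart_apply, div_eq_inv_mul]
  have hY : numY w z = ofComplex l (-l⁻¹ * d) := by
    ext
    · simp [numY, partialY, hre'.fderiv, ofComplex, chart_apply]; ring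
    · simp [numY, partialY, him'.fderiv, ofComplex, chart_apply, div_eq_inv_mul]
  have hX' : toComplex l (numX w z) = d := by rw [hX, toComplex_ofComplex him]
  have hY' : toComplex l (numY w z) = -l⁻¹ * d := by rw [hY, toComplex_ofComplex him]
  exact ⟨hre'.differentiableAt, him'.differentiableAt, hX', hY',
    (dbar_eq_zero_iff hl him w z).2 (by rw [hX', hY'])⟩

theorem IsHolomorphicOn.hasDerivAt (hl : l * l = -α - β * l) (him : l.im ≠ 0)
    {w : ℝ × ℝ → Num α β} {U : Set (ℝ × ℝ)} (hU : IsOpen U) (hw : IsHolomorphicOn w U)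
    {z : ℝ × ℝ} (hz : z ∈ U) :
    HasDerivAt (toComplexFun l him w) (toComplex l (numX w z)) (chart l him z) :=
  hasDerivAt_toComplexFun hl him (hw.differentiableOn_re.differentiableAt (hU.mem_nhds hz))
    (hw.differentiableOn_im.differentiableAt (hU.mem_nhds hz)) (hw.dbar_eq_zero z hz)

theorem isHolomorphicOn_of_differentiableAt (hl : l * l = -α - β * l) (him : l.im ≠ 0)
    {w : ℝ × ℝ → Num α β} {U : Set (ℝ × ℝ)}
    (h : ∀ z ∈ U, DifferentiableAt ℂ (toComplexFun l him w) (chart l him z)) :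
    IsHolomorphicOn w U where
  differentiableOn_re z hz :=
    (of_hasDerivAt_toComplexFun hl him (h z hz).hasDerivAt).1.differentiableWithinAt
  differentiableOn_im z hz :=
    (of_hasDerivAt_toComplexFun hl him (h z hz).hasDerivAt).2.1.differentiableWithinAt
  dbar_eq_zero z hz := (of_hasDerivAt_toComplexFun hl him (h z hz).hasDerivAt).2.2.2.2

theorem isOpen_chart_preimage (him : l.im ≠ 0) {U : Set (ℝ × ℝ)} (hU : IsOpen U) :
    IsOpen ((chart l him).symm ⁻¹' U) :=
  hU.preimage (chart l him).symm.continuous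

theorem isHolomorphicOn_iff (hl : l * l = -α - β * l) (him : l.im ≠ 0)
    {w : ℝ × ℝ → Num α β} {U : Set (ℝ × ℝ)} (hU : IsOpen U) :
    IsHolomorphicOn w U ↔
      DifferentiableOn ℂ (toComplexFun l him w) ((chart l him).symm ⁻¹' U) := by
  constructor
  · intro hw ζ hζ
    have := hw.hasDerivAt hl him hU hζ
    rw [ContinuousLinearEquiv.apply_symm_apply] at this
    exact this.differentiableAt.differentiableWithinAt
  · intro h
    refine isHolomorphicOn_of_differentiableAt hl him fun z hz => ?_
    exact h.differentiableAt ((isOpen_chart_preimage him hU).mem_nhds (by simpa using hz))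

/-- The function of the plane represented by `F`. -/
def ofComplexFun (l : ℂ) (him : l.im ≠ 0) (F : ℂ → ℂ) (z : ℝ × ℝ) : Num α β :=
  ofComplex l (F (chart l him z))

theorem toComplexFun_ofComplexFun (him : l.im ≠ 0) (F : ℂ → ℂ) :
    toComplexFun l him (ofComplexFun l him F : ℝ × ℝ → Num α β) = F := by
  ext ζ
  simp [toComplexFun, ofComplexFun, toComplex_ofComplex him]

/-- For coefficients of the stated form the right-hand side is `A ∂ₓ w + E w + G`. -/
theorem RealSystem.IsGivenBy.rhs_eq {S : RealSystem} {T : ℝ} {Ω : Set (ℝ × ℝ)}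
    {A E G : ℝ → ℝ × ℝ → Num α β} (h : S.IsGivenBy T Ω A E G) {t : ℝ} (ht : t ∈ Icc 0 T)
    {z : ℝ × ℝ} (hz : z ∈ Ω) {w : ℝ × ℝ → Num α β} (hw : dbar w z = 0) :
    S.rhs t w z = A t z * numX w z + E t z * w z + G t z := by
  have h1 := congrArg QuadraticAlgebra.re hw
  have h2 := congrArg QuadraticAlgebra.im hw
  simp [dbar] at h1 h2
  ext
  · simp only [RealSystem.rhs, RealSystem.rhsU, h.a₂₁_eq t ht z hz, h.a₂₂_eq t ht z hz,
      h.c₁_eq t ht z hz, h.c₂_eq t ht z hz, h.c₃_eq t ht z hz, QuadraticAlgebra.re_add,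
      QuadraticAlgebra.re_mul, numX]
    -- The free coefficients enter only as multipliers of the two Cauchy-Riemann equations.
    linear_combination 2 * (S.a₁₁ t z - (A t z).re) * h1 + 2 * S.a₁₂ t z * h2
  · simp only [RealSystem.rhs, RealSystem.rhsV, h.b₂₁_eq t ht z hz, h.b₂₂_eq t ht z hz,
      h.d₁_eq t ht z hz, h.d₂_eq t ht z hz, h.d₃_eq t ht z hz, QuadraticAlgebra.im_add,
      QuadraticAlgebra.im_mul, numX]
    linear_combination 2 * (S.b₁₁ t z - (A t z).im) * h1 + 2 * S.b₁₂ t z * h2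

theorem RealSystem.IsGivenBy.isAssociated (hl : l * l = -α - β * l) (him : l.im ≠ 0)
    {S : RealSystem} {T : ℝ} {Ω : Set (ℝ × ℝ)} (hΩ : IsOpen Ω)
    {A E G : ℝ → ℝ × ℝ → Num α β} (h : S.IsGivenBy T Ω A E G) : S.IsAssociated α β T Ω := by
  intro t ht w hw
  rw [isHolomorphicOn_iff hl him hΩ]
  have hA := (isHolomorphicOn_iff hl him hΩ).1 (h.holomorphic_A t ht)
  have hE := (isHolomorphicOn_iff hl him hΩ).1 (h.holomorphic_E t ht)
  have hG := (isHolomorphicOn_iff hl him hΩ).1 (h.holomorphic_G t ht)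
  have hW := (isHolomorphicOn_iff hl him hΩ).1 hw
  refine (((hA.mul (hW.deriv (isOpen_chart_preimage him hΩ))).add (hE.mul hW)).add hG).congr
    fun ζ hζ => ?_
  have hd := hw.hasDerivAt hl him hΩ hζ
  rw [ContinuousLinearEquiv.apply_symm_apply] at hd
  simp only [Pi.add_apply, Pi.mul_apply, hd.deriv]
  simp only [toComplexFun, h.rhs_eq ht hζ (hw.dbar_eq_zero _ hζ), toComplex_add,
    toComplex_mul hl]

end Embedding

/-! ### Necessity of the form of the coefficients -/

theorem hasDerivAt_smul_zero {φ : ℝ → ℂ} (hφ : ContinuousAt φ 0) :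
    HasDerivAt (fun t : ℝ => (t : ℂ) * φ t) (φ 0) 0 := by
  rw [hasDerivAt_iff_tendsto_slope]
  refine (hφ.tendsto.mono_left nhdsWithin_le_nhds).congr' ?_
  filter_upwards [self_mem_nhdsWithin] with t ht
  have : (t : ℂ) ≠ 0 := by exact_mod_cast ht
  simp [slope, this]

/-- A product of `conj (ζ - ζ₀)` with a continuous function is complex differentiable at `ζ₀` only
if that function vanishes there. -/
theorem eq_zero_of_differentiableAt_conj_mul {g : ℂ → ℂ} {ζ₀ : ℂ} (hg : ContinuousAt g ζ₀)
    (hd : DifferentiableAt ℂ (fun ζ => (starRingEnd ℂ) (ζ - ζ₀) * g ζ) ζ₀) : g ζ₀ = 0 := by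
  -- The derivative along `ζ₀ + t c` is complex linear in `c` on one side and conjugate linear on
  -- the other; `c = 1` and `c = I` then force it to vanish.
  have key : ∀ c : ℂ, deriv (fun ζ => (starRingEnd ℂ) (ζ - ζ₀) * g ζ) ζ₀ * c =
      (starRingEnd ℂ) c * g ζ₀ := by
    intro c
    have hline : HasDerivAt (fun t : ℝ => ζ₀ + t * c) c 0 := by
      have := ((Complex.ofRealCLM.hasDerivAt (x := 0)).mul_const c).const_add ζ₀
      simpa using this
    have hcont : ContinuousAt (fun t : ℝ => (starRingEnd ℂ) c * g (ζ₀ + t * c)) 0 := by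
      refine continuousAt_const.mul (ContinuousAt.comp (f := fun t : ℝ => ζ₀ + t * c) ?_
        hline.continuousAt)
      simpa using hg
    have h1 : HasDerivAt (fun t : ℝ => (starRingEnd ℂ) ((ζ₀ + t * c) - ζ₀) * g (ζ₀ + t * c))
        (deriv (fun ζ => (starRingEnd ℂ) (ζ - ζ₀) * g ζ) ζ₀ * c) 0 := by
      refine HasDerivAt.comp (h₂ := fun ζ => (starRingEnd ℂ) (ζ - ζ₀) * g ζ) (0 : ℝ) ?_ hline
      simpa using hd.hasDerivAt
    have h2 := hasDerivAt_smul_zero hcont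
    have h3 : (fun t : ℝ => (starRingEnd ℂ) ((ζ₀ + t * c) - ζ₀) * g (ζ₀ + t * c)) =
        fun t : ℝ => (t : ℂ) * ((starRingEnd ℂ) c * g (ζ₀ + t * c)) := by
      ext t
      simp
      ring
    rw [h3] at h1
    simpa using h1.unique h2
  have h1 := key 1
  have h2 := key Complex.I
  simp only [mul_one, map_one, one_mul, Complex.conj_I] at h1 h2
  rw [h1] at h2
  have h3 : 2 * Complex.I * g ζ₀ = 0 := by linear_combination h2
  simpa using h3

/-- A first order real-linear operator preserving holomorphy is complex linear, with holomorphic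
coefficients. -/
theorem complexLinear_of_preserves {p q b k g : ℂ → ℂ} {V : Set ℂ} (hV : IsOpen V)
    (h : ∀ F : ℂ → ℂ, Differentiable ℂ F → DifferentiableOn ℂ (fun ζ =>
      deriv F ζ * p ζ + F ζ * q ζ + (deriv F ζ).im * b ζ + (F ζ).im * k ζ + g ζ) V) :
    DifferentiableOn ℂ p V ∧ DifferentiableOn ℂ q V ∧ DifferentiableOn ℂ g V ∧
      (∀ ζ ∈ V, b ζ = 0) ∧ ∀ ζ ∈ V, k ζ = 0 := by
  have hg : DifferentiableOn ℂ g V := by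
    simpa using h (fun _ => 0) (differentiable_const _)
  have hH : ∀ F : ℂ → ℂ, Differentiable ℂ F → DifferentiableOn ℂ (fun ζ =>
      deriv F ζ * p ζ + F ζ * q ζ + (deriv F ζ).im * b ζ + (F ζ).im * k ζ) V := fun F hF =>
    ((h F hF).sub hg).congr fun ζ _ => by simp
  have hq : DifferentiableOn ℂ q V := by
    simpa using hH (fun _ => 1) (differentiable_const _)
  -- Subtracting `I` times the image of `F` from the image of `I F` removes the complex linear part,
  -- and `Im (I c) - I Im c = conj c`.
  have hconj : ∀ F : ℂ → ℂ, Differentiable ℂ F → DifferentiableOn ℂ (fun ζ =>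
      (starRingEnd ℂ) (deriv F ζ) * b ζ + (starRingEnd ℂ) (F ζ) * k ζ) V := by
    intro F hF
    have h1 := hH F hF
    have h2 := hH (fun ζ => Complex.I * F ζ) (hF.const_mul _)
    refine (h2.sub (h1.const_mul Complex.I)).congr fun ζ _ => ?_
    have h3 : ∀ c : ℂ, (starRingEnd ℂ) c = (c.re : ℂ) - c.im * Complex.I := fun c => by
      apply Complex.ext <;> simp
    simp only [deriv_const_mul_field', Pi.sub_apply, h3]
    simp
    ring
  have hk : DifferentiableOn ℂ k V := by
    simpa using hconj (fun _ => 1) (differentiable_const _)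
  have hbk : DifferentiableOn ℂ (fun ζ => b ζ + (starRingEnd ℂ) ζ * k ζ) V := by
    simpa using hconj (fun ζ => ζ) differentiable_id
  -- No regularity of `b` is given in advance; its continuity comes from the test functions `1` and
  -- `ζ`.
  have hbc : ContinuousOn b V :=
    (hbk.continuousOn.sub (Complex.continuous_conj.continuousOn.mul hk.continuousOn)).congr
      fun ζ _ => by simp
  have hb0 : ∀ ζ ∈ V, b ζ = 0 := by
    intro ζ₀ hζ₀
    have hn := hV.mem_nhds hζ₀
    -- For this square both terms contain `conj (ζ - ζ₀)`, and the cofactor is `2 b` at `ζ₀`.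
    have h1 := hconj (fun ζ => (ζ - ζ₀) ^ 2) (by fun_prop)
    have hd : ∀ ζ, deriv (fun ζ => (ζ - ζ₀) ^ 2) ζ = 2 * (ζ - ζ₀) := fun ζ => by
      simp
    have h2 := eq_zero_of_differentiableAt_conj_mul (ζ₀ := ζ₀)
      (g := fun ζ => 2 * b ζ + (starRingEnd ℂ) (ζ - ζ₀) * k ζ) ?_ ?_
    · simpa using h2
    · exact ((hbc.continuousAt hn).const_mul 2).add
        ((Complex.continuous_conj.comp (continuous_id.sub continuous_const)).continuousAt.mul
          (hk.continuousOn.continuousAt hn))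
    · refine (h1.differentiableAt hn).congr_of_eventuallyEq (Eventually.of_forall fun ζ => ?_)
      have h2 : (starRingEnd ℂ) 2 = 2 := Complex.conj_ofNat 2
      simp [hd, h2]
      ring
  have hk0 : ∀ ζ ∈ V, k ζ = 0 := by
    intro ζ₀ hζ₀
    have hn := hV.mem_nhds hζ₀
    refine eq_zero_of_differentiableAt_conj_mul (hk.continuousOn.continuousAt hn) ?_
    have h1 := (hconj (fun ζ => ζ - ζ₀) (by fun_prop)).differentiableAt hn
    refine h1.congr_of_eventuallyEq ?_
    filter_upwards [hn] with ζ hζ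
    simp [hb0 ζ hζ]
  refine ⟨?_, hq, hg, hb0, hk0⟩
  have h1 := (hH (fun ζ => ζ) differentiable_id).sub (differentiableOn_id.mul hq)
  refine h1.congr fun ζ hζ => ?_
  simp [hk0 ζ hζ]

section Necessity

variable {α β : ℝ} {l : ℂ}

theorem RealSystem.IsAssociated.exists_isGivenBy (hα : 0 < α) (hl : l * l = -α - β * l)
    (him : l.im ≠ 0) {S : RealSystem} {T : ℝ} {Ω : Set (ℝ × ℝ)} (hΩ : IsOpen Ω)
    (h : S.IsAssociated α β T Ω) :
    ∃ A E G : ℝ → ℝ × ℝ → Num α β, S.IsGivenBy T Ω A E G := by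
  have hl0 : l ≠ 0 := by rintro rfl; exact him rfl
  have hα' : (α : ℂ) ≠ 0 := by exact_mod_cast hα.ne'
  have him' : (l.im : ℂ) ≠ 0 := by exact_mod_cast him
  -- Eliminating the `y`-derivatives by Cauchy-Riemann leaves `A`, `A'`, `E`, `E'` as the
  -- coefficients of `∂ₓ u`, `∂ₓ v`, `u`, `v`. The claim becomes `A' = i A` and `E' = i E`.
  set A : ℝ → ℝ × ℝ → Num α β := fun t z =>
    ⟨S.a₁₁ t z + S.a₁₂ t z * (β / α) + S.a₂₂ t z / α,
      S.b₁₁ t z + S.b₁₂ t z * (β / α) + S.b₂₂ t z / α⟩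
  set A' : ℝ → ℝ × ℝ → Num α β := fun t z =>
    ⟨S.a₂₁ t z - S.a₁₂ t z, S.b₂₁ t z - S.b₁₂ t z⟩
  set E : ℝ → ℝ × ℝ → Num α β := fun t z => ⟨S.c₁ t z, S.d₁ t z⟩
  set E' : ℝ → ℝ × ℝ → Num α β := fun t z => ⟨S.c₂ t z, S.d₂ t z⟩
  set G : ℝ → ℝ × ℝ → Num α β := fun t z => ⟨S.c₃ t z, S.d₃ t z⟩
  have hrhs : ∀ t z (w : ℝ × ℝ → Num α β), dbar w z = 0 →
      toComplex l (S.rhs t w z) = (numX w z).re * toComplex l (A t z) +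
        (numX w z).im * toComplex l (A' t z) + (w z).re * toComplex l (E t z) +
        (w z).im * toComplex l (E' t z) + toComplex l (G t z) := by
    intro t z w hw
    have h1 := congrArg QuadraticAlgebra.re hw
    have h2 := congrArg QuadraticAlgebra.im hw
    simp [dbar] at h1 h2
    have h3 : partialY (fun p => (w p).im) z = partialX (fun p => (w p).re) z / α := by
      field_simp; linarith
    have h4 : partialY (fun p => (w p).re) z =
        β / α * partialX (fun p => (w p).re) z - partialX (fun p => (w p).im) z := by
      rw [h3] at h2; field_simp at h2 ⊢; linarith
    simp only [RealSystem.rhs, RealSystem.rhsU, RealSystem.rhsV, h3, h4, toComplex, numX,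
      A, A', E, E', G]
    push_cast
    ring
  have main : ∀ t ∈ Icc 0 T,
      DifferentiableOn ℂ (toComplexFun l him (A t)) ((chart l him).symm ⁻¹' Ω) ∧
      DifferentiableOn ℂ (toComplexFun l him (E t)) ((chart l him).symm ⁻¹' Ω) ∧
      DifferentiableOn ℂ (toComplexFun l him (G t)) ((chart l him).symm ⁻¹' Ω) ∧
      (∀ ζ ∈ (chart l him).symm ⁻¹' Ω,
        (toComplexFun l him (A' t) ζ - l * toComplexFun l him (A t) ζ) / l.im = 0) ∧
      ∀ ζ ∈ (chart l him).symm ⁻¹' Ω,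
        (toComplexFun l him (E' t) ζ - l * toComplexFun l him (E t) ζ) / l.im = 0 := by
    intro t ht
    -- Here `∂ₓ v = Im F' / Im l` and `∂ₓ u = F' - l ∂ₓ v`, so the coefficient of `Im F'` is `(A' -
    -- l A) / Im l`; the same holds for `F` with `E`.
    refine complexLinear_of_preserves (isOpen_chart_preimage him hΩ) fun F hF => ?_
    have hw : ∀ ζ, HasDerivAt
        (toComplexFun l him (ofComplexFun l him F : ℝ × ℝ → Num α β)) (deriv F ζ)
        (chart l him ((chart l him).symm ζ)) := fun ζ => by
      rw [toComplexFun_ofComplexFun, ContinuousLinearEquiv.apply_symm_apply]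
      exact (hF ζ).hasDerivAt
    have hhol : IsHolomorphicOn (ofComplexFun l him F : ℝ × ℝ → Num α β) Ω := by
      rw [isHolomorphicOn_iff hl him hΩ, toComplexFun_ofComplexFun]
      exact hF.differentiableOn
    refine ((isHolomorphicOn_iff hl him hΩ).1 (h t ht _ hhol)).congr fun ζ hζ => ?_
    have hd := of_hasDerivAt_toComplexFun hl him (hw ζ)
    have hX : numX (ofComplexFun l him F : ℝ × ℝ → Num α β) ((chart l him).symm ζ) =
        ofComplex l (deriv F ζ) := by
      rw [← hd.2.2.1, ofComplex_toComplex him]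
    have hsplit : ∀ c : ℂ, c = ((ofComplex l c : Num α β).re : ℂ) +
        ((ofComplex l c : Num α β).im : ℂ) * l := fun c =>
      (toComplex_ofComplex (α := α) (β := β) him c).symm
    have hval : (ofComplexFun l him F : ℝ × ℝ → Num α β) ((chart l him).symm ζ) =
        ofComplex l (F ζ) := by simp [ofComplexFun]
    have him2 : ∀ c : ℂ, ((ofComplex l c : Num α β).im : ℂ) = c.im / l.im := fun c => by
      simp [ofComplex]
    change _ = toComplex l (S.rhs t _ _)
    rw [hrhs t _ _ hd.2.2.2.2, hX, hval]
    simp only [toComplexFun]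
    have e1 := hsplit (deriv F ζ)
    have e2 := hsplit (F ζ)
    rw [him2] at e1 e2 ⊢
    rw [him2]
    linear_combination toComplex l (A t ((chart l him).symm ζ)) * e1 +
      toComplex l (E t ((chart l him).symm ζ)) * e2
  have hi : ∀ X : Num α β, l * toComplex l X = toComplex l ((⟨0, 1⟩ : Num α β) * X) := fun X => by
    rw [toComplex_mul hl]; simp [toComplex]
  have key : ∀ t ∈ Icc 0 T, ∀ z ∈ Ω, A' t z = (⟨0, 1⟩ : Num α β) * A t z ∧
      E' t z = (⟨0, 1⟩ : Num α β) * E t z := by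
    intro t ht z hz
    obtain ⟨-, -, -, h1, h2⟩ := main t ht
    have hz' : chart l him z ∈ (chart l him).symm ⁻¹' Ω := by simpa using hz
    have h3 := h1 _ hz'
    have h4 := h2 _ hz'
    simp only [toComplexFun_chart, hi, div_eq_zero_iff, him', or_false, sub_eq_zero] at h3 h4
    exact ⟨toComplex_injective him h3, toComplex_injective him h4⟩
  refine ⟨A, E, G, ⟨fun t ht => (isHolomorphicOn_iff hl him hΩ).2 (main t ht).1,
    fun t ht => (isHolomorphicOn_iff hl him hΩ).2 (main t ht).2.1,
    fun t ht => (isHolomorphicOn_iff hl him hΩ).2 (main t ht).2.2.1,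
    ?_, ?_, ?_, ?_, fun _ _ _ _ => rfl, fun _ _ _ _ => rfl, ?_, ?_,
    fun _ _ _ _ => rfl, fun _ _ _ _ => rfl⟩⟩
  · intro t ht z hz
    have := congrArg QuadraticAlgebra.re (key t ht z hz).1
    simp [A'] at this
    linarith
  · intro t ht z hz
    simp only [A]; field_simp; ring
  · intro t ht z hz
    have := congrArg QuadraticAlgebra.im (key t ht z hz).1
    simp [A'] at this
    linarith
  · intro t ht z hz
    simp only [A]; field_simp; ring
  · intro t ht z hz
    have := congrArg QuadraticAlgebra.re (key t ht z hz).2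
    simp [E'] at this
    linarith
  · intro t ht z hz
    have := congrArg QuadraticAlgebra.im (key t ht z hz).2
    simp [E'] at this
    linarith

end Necessity

/-! ### Solutions of the system and the choice of the weight -/

section Existence

variable {α β : ℝ} {l : ℂ}

/-- Freezing the coefficients outside `[0, T]` extends them to all times, so the equation is solved
across the endpoints and the one-sided derivatives follow by restriction. -/
theorem isHolomorphicFamily_clamp (hl : l * l = -α - β * l) (him : l.im ≠ 0) {T : ℝ} (hT : 0 ≤ T)
    {Ω : Set (ℝ × ℝ)} (hΩ : IsOpen Ω) {A : ℝ → ℝ × ℝ → Num α β}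
    (hA : ∀ t ∈ Icc 0 T, IsHolomorphicOn (A t) Ω)
    (hre : ContinuousOn (fun p : ℝ × (ℝ × ℝ) => (A p.1 p.2).re) (Icc 0 T ×ˢ Ω))
    (him' : ContinuousOn (fun p : ℝ × (ℝ × ℝ) => (A p.1 p.2).im) (Icc 0 T ×ˢ Ω)) :
    IsHolomorphicFamily (fun t => toComplexFun l him (A (projIcc 0 T hT t)))
      ((chart l him).symm ⁻¹' Ω) := by
  refine ⟨?_, fun t => (isHolomorphicOn_iff hl him hΩ).1 (hA _ (projIcc 0 T hT t).2)⟩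
  have hmap : ContinuousOn (fun p : ℝ × ℂ =>
      (((projIcc 0 T hT p.1 : Icc 0 T) : ℝ), (chart l him).symm p.2))
      (univ ×ˢ ((chart l him).symm ⁻¹' Ω)) := by
    refine Continuous.continuousOn (Continuous.prodMk ?_ ?_)
    · exact continuous_subtype_val.comp (continuous_projIcc.comp continuous_fst)
    · exact (chart l him).symm.continuous.comp continuous_snd
  have hmaps : MapsTo (fun p : ℝ × ℂ =>
      (((projIcc 0 T hT p.1 : Icc 0 T) : ℝ), (chart l him).symm p.2))
      (univ ×ˢ ((chart l him).symm ⁻¹' Ω)) (Icc 0 T ×ˢ Ω) :=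
    fun p hp => ⟨(projIcc 0 T hT p.1).2, hp.2⟩
  exact (Complex.continuous_ofReal.comp_continuousOn (hre.comp hmap hmaps)).add
    ((Complex.continuous_ofReal.comp_continuousOn (him'.comp hmap hmaps)).mul continuousOn_const)

/-- The data of a solution of the system at the time `t` and the point `z`. -/
structure IsSolutionAt (S : RealSystem) (w : ℝ → ℝ × ℝ → Num α β) (t : ℝ) (z : ℝ × ℝ) : Prop where
  continuousAt_re : ContinuousAt (fun p : ℝ × (ℝ × ℝ) => (w p.1 p.2).re) (t, z)
  continuousAt_im : ContinuousAt (fun p : ℝ × (ℝ × ℝ) => (w p.1 p.2).im) (t, z)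
  differentiableAt_re : DifferentiableAt ℝ (fun p => (w t p).re) z
  differentiableAt_im : DifferentiableAt ℝ (fun p => (w t p).im) z
  dbar_eq_zero : dbar (w t) z = 0
  hasDerivAt_re : HasDerivAt (fun r => (w r z).re) (S.rhs t (w t) z).re t
  hasDerivAt_im : HasDerivAt (fun r => (w r z).im) (S.rhs t (w t) z).im t

/-- `A` is only assumed holomorphic at each time; joint continuity comes from solving for it in
terms of the coefficients, which needs `α ≠ 0`. -/
theorem RealSystem.IsGivenBy.continuousOn_A (hα : 0 < α) {S : RealSystem} {T : ℝ}
    {Ω : Set (ℝ × ℝ)} (hS : S.IsContinuous T Ω) {A E G : ℝ → ℝ × ℝ → Num α β}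
    (h : S.IsGivenBy T Ω A E G) :
    ContinuousOn (fun p : ℝ × (ℝ × ℝ) => (A p.1 p.2).re) (Icc 0 T ×ˢ Ω) ∧
      ContinuousOn (fun p : ℝ × (ℝ × ℝ) => (A p.1 p.2).im) (Icc 0 T ×ˢ Ω) := by
  have hcont : ∀ f ∈ [S.a₁₁, S.a₁₂, S.a₂₁, S.a₂₂, S.b₁₁, S.b₁₂, S.b₂₁, S.b₂₂,
      S.c₁, S.c₂, S.c₃, S.d₁, S.d₂, S.d₃],
      ContinuousOn (fun p : ℝ × (ℝ × ℝ) => f p.1 p.2) (Icc 0 T ×ˢ Ω) := hS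
  simp only [List.forall_mem_cons] at hcont
  obtain ⟨h11, h12, h21, h22, -, -, -, -, -⟩ := hcont
  constructor
  · refine ((((h22.add (h11.const_smul α)).add (h12.const_smul β))).const_smul (1 / α)).congr
      fun p hp => ?_
    have := h.a₂₂_eq p.1 hp.1 p.2 hp.2
    simp only [Pi.add_apply, Pi.smul_apply, smul_eq_mul, this]
    field_simp; ring
  · refine ((h12.sub h21).const_smul (1 / α)).congr fun p hp => ?_
    have := h.a₂₁_eq p.1 hp.1 p.2 hp.2
    simp only [Pi.sub_apply, Pi.smul_apply, smul_eq_mul, this]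
    field_simp; ring

theorem RealSystem.IsGivenBy.exists_solution (hα : 0 < α) (hl : l * l = -α - β * l)
    (him : l.im ≠ 0) {S : RealSystem} {T : ℝ} (hT : 0 < T) {Ω : Set (ℝ × ℝ)} (hΩ : IsOpen Ω)
    (hS : S.IsContinuous T Ω) {A E G : ℝ → ℝ × ℝ → Num α β} (h : S.IsGivenBy T Ω A E G) :
    ∃ c > 0, ∀ ρ : ℝ × ℝ → Num α β, IsHolomorphicOn ρ Ω →
      ∃ w : ℝ → ℝ × ℝ → Num α β, (∀ z, w 0 z = ρ z) ∧
        ∀ z r K t, closedBall z r ⊆ Ω → 0 < r → 0 < K →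
          (∀ t ∈ Icc 0 T, ∀ y ∈ closedBall z r, ‖toComplex l (A t y)‖ ≤ K) →
          t ∈ Icc 0 T → K * t < c * r → IsSolutionAt S w t z := by
  set χ := chart l him
  set V := χ.symm ⁻¹' Ω
  have hV : IsOpen V := isOpen_chart_preimage him hΩ
  set N : ℝ := ‖(χ.symm : ℂ →L[ℝ] ℝ × ℝ)‖ + 1
  have hN : 0 < N := by positivity
  have hdist : ∀ ζ z, dist (χ.symm ζ) z ≤ N * dist ζ (χ z) := fun ζ z => by
    have h1 := (χ.symm : ℂ →L[ℝ] ℝ × ℝ).lipschitz.dist_le_mul ζ (χ z)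
    simp only [ContinuousLinearEquiv.coe_coe, ContinuousLinearEquiv.symm_apply_apply,
      coe_nnnorm] at h1
    refine h1.trans ?_
    simp only [N]
    nlinarith [dist_nonneg (x := ζ) (y := χ z)]
  have hcont : ∀ f ∈ [S.a₁₁, S.a₁₂, S.a₂₁, S.a₂₂, S.b₁₁, S.b₁₂, S.b₂₁, S.b₂₂,
      S.c₁, S.c₂, S.c₃, S.d₁, S.d₂, S.d₃],
      ContinuousOn (fun p : ℝ × (ℝ × ℝ) => f p.1 p.2) (Icc 0 T ×ˢ Ω) := hS
  simp only [List.forall_mem_cons] at hcont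
  obtain ⟨-, -, -, -, -, -, -, -, hc1, -, hc3, hd1, -, hd3, -⟩ := hcont
  obtain ⟨hAre, hAim⟩ := h.continuousOn_A hα hS
  have ha := isHolomorphicFamily_clamp hl him hT.le hΩ h.holomorphic_A hAre hAim
  have he := isHolomorphicFamily_clamp hl him hT.le hΩ h.holomorphic_E
    (hc1.congr fun p hp => (h.c₁_eq p.1 hp.1 p.2 hp.2).symm)
    (hd1.congr fun p hp => (h.d₁_eq p.1 hp.1 p.2 hp.2).symm)
  have hg := isHolomorphicFamily_clamp hl him hT.le hΩ h.holomorphic_G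
    (hc3.congr fun p hp => (h.c₃_eq p.1 hp.1 p.2 hp.2).symm)
    (hd3.congr fun p hp => (h.d₃_eq p.1 hp.1 p.2 hp.2).symm)
  -- The inverse chart maps the ball of radius `r / N` into that of radius `r`, and the cone has
  -- slope `8 K`.
  refine ⟨1 / (8 * N), by positivity, fun ρ hρ => ?_⟩
  obtain ⟨W, hW0, hW⟩ := EllipticCR.exists_solution hV ha he hg
    ((isHolomorphicOn_iff hl him hΩ).1 hρ) (fun K hKV hK => by
      obtain ⟨C, -, hC⟩ := he.exists_bound (isCompact_Icc (a := 0) (b := T)) hK hKV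
      refine ⟨C, fun t ζ hζ => ?_⟩
      have := hC (projIcc 0 T hT.le t) (projIcc 0 T hT.le t).2 ζ hζ
      rwa [projIcc_val] at this)
  refine ⟨fun t => ofComplexFun l him (W t), fun z => ?_, ?_⟩
  · change ofComplex l (W 0 (chart l him z)) = _
    rw [hW0, toComplexFun_chart, ofComplex_toComplex him]
  intro z r K t hball hr hK hAK ht htr
  have hsub : ∀ ζ ∈ closedBall (χ z) (r / N), χ.symm ζ ∈ closedBall z r := fun ζ hζ => by
    have h1 := mem_closedBall.1 hζ
    rw [le_div_iff₀ hN] at h1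
    exact mem_closedBall.2 ((hdist ζ z).trans (by linarith))
  obtain ⟨hWc, hWd, hWt⟩ := hW (χ z) (r / N) K t (fun ζ hζ => hball (hsub ζ hζ)) (by positivity)
    hK (fun s ζ hζ => hAK _ (projIcc 0 T hT.le s).2 _ (hsub ζ hζ)) (by
      rw [abs_of_nonneg ht.1, lt_div_iff₀ hN]
      have : 1 / (8 * N) * r = r / (8 * N) := by ring
      rw [this, lt_div_iff₀ (by positivity)] at htr
      linarith)
  have hz : z ∈ Ω := hball (mem_closedBall_self hr.le)
  have hd := hWd.hasDerivAt
  rw [← toComplexFun_ofComplexFun (α := α) (β := β) him (W t)] at hd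
  obtain ⟨h1, h2, hX, hY, h3⟩ := of_hasDerivAt_toComplexFun hl him hd
  rw [toComplexFun_ofComplexFun] at hX
  have hrhs : toComplex l (S.rhs t (ofComplexFun l him (W t) : ℝ × ℝ → Num α β) z) =
      toComplexFun l him (A (projIcc 0 T hT.le t)) (χ z) * deriv (W t) (χ z) +
        toComplexFun l him (E (projIcc 0 T hT.le t)) (χ z) * W t (χ z) +
        toComplexFun l him (G (projIcc 0 T hT.le t)) (χ z) := by
    rw [h.rhs_eq ht hz h3, toComplex_add, toComplex_add, toComplex_mul hl, toComplex_mul hl, hX,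
      projIcc_of_mem hT.le ht, toComplexFun_chart, toComplexFun_chart, toComplexFun_chart]
    simp only [ofComplexFun, toComplex_ofComplex him]
    rfl
  rw [← hrhs] at hWt
  have hWc' : ContinuousAt (fun p : ℝ × (ℝ × ℝ) => W p.1 (χ p.2)) (t, z) := by
    refine ContinuousAt.comp (g := fun p : ℝ × ℂ => W p.1 p.2)
      (f := fun p : ℝ × (ℝ × ℝ) => (p.1, χ p.2)) hWc ?_
    exact (continuous_fst.prodMk (χ.continuous.comp continuous_snd)).continuousAt
  have hcoord := ofComplex_toComplex him
    (S.rhs t (ofComplexFun l him (W t) : ℝ × ℝ → Num α β) z)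
  have hre : HasDerivAt (fun s => (W s (χ z)).re) _ t :=
    Complex.reCLM.hasFDerivAt.comp_hasDerivAt t hWt
  have him' : HasDerivAt (fun s => (W s (χ z)).im) _ t :=
    Complex.imCLM.hasFDerivAt.comp_hasDerivAt t hWt
  refine ⟨?_, ?_, h1, h2, h3, ?_, ?_⟩
  · exact (Complex.continuous_re.continuousAt.comp hWc').sub
      (((Complex.continuous_im.continuousAt.comp hWc').div_const _).mul_const _)
  · exact (Complex.continuous_im.continuousAt.comp hWc').div_const _
  · refine (hre.sub ((him'.div_const l.im).mul_const l.re)).congr_deriv ?_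
    exact congrArg QuadraticAlgebra.re hcoord
  · refine (him'.div_const l.im).congr_deriv ?_
    exact congrArg QuadraticAlgebra.im hcoord

theorem isSolvableAlong_of_isSolutionAt {S : RealSystem} {Ω : Set (ℝ × ℝ)} {s₀ h : ℝ}
    {D : ℝ → Set (ℝ × ℝ)}
    (hsol : ∀ ρ : ℝ × ℝ → Num α β, IsHolomorphicOn ρ Ω →
      ∃ w : ℝ → ℝ × ℝ → Num α β, (∀ z, w 0 z = ρ z) ∧
        ∀ s ∈ Ioo 0 s₀, ∀ z ∈ D s, ∀ t ∈ Icc 0 (h * (s₀ - s)), IsSolutionAt S w t z) :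
    S.IsSolvableAlong α β Ω s₀ D h := by
  intro ρ hρ
  obtain ⟨w, hw0, hw⟩ := hsol ρ hρ
  refine ⟨w, fun s hs => ⟨?_, fun t ht => ?_⟩⟩
  · exact
    { continuousOn_u := fun p hp =>
        (hw s hs p.2 hp.2 p.1 hp.1).continuousAt_re.continuousWithinAt
      continuousOn_v := fun p hp =>
        (hw s hs p.2 hp.2 p.1 hp.1).continuousAt_im.continuousWithinAt
      differentiableOn_u := fun t ht z hz =>
        (hw s hs z hz t ht).differentiableAt_re.differentiableWithinAt
      differentiableOn_v := fun t ht z hz =>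
        (hw s hs z hz t ht).differentiableAt_im.differentiableWithinAt
      initial_u := fun z _ => by rw [hw0]
      initial_v := fun z _ => by rw [hw0]
      hasDeriv_u := fun t ht z hz => (hw s hs z hz t ht).hasDerivAt_re.hasDerivWithinAt
      hasDeriv_v := fun t ht z hz => (hw s hs z hz t ht).hasDerivAt_im.hasDerivWithinAt }
  · exact ⟨fun z hz => (hw s hs z hz t ht).differentiableAt_re.differentiableWithinAt,
      fun z hz => (hw s hs z hz t ht).differentiableAt_im.differentiableWithinAt,
      fun z hz => (hw s hs z hz t ht).dbar_eq_zero⟩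

/-- Radii `r ≤ 1` of balls about `z` inside `Ω` on which `f` is bounded by `1 / r`. -/
def admissibleRadii {X : Type*} [PseudoMetricSpace X] (T : ℝ) (Ω : Set X) (f : ℝ → X → ℂ) (z : X) :
    Set ℝ :=
  {r | 0 < r ∧ r ≤ 1 ∧ closedBall z r ⊆ Ω ∧ ∀ t ∈ Icc 0 T, ∀ y ∈ closedBall z r, ‖f t y‖ ≤ 1 / r}

/-- The weight is the supremum of the admissible radii. Moving the centre by `d` costs at most `d`
of the radius, and the bound `1 / r` only relaxes as `r` shrinks, so it is 1-Lipschitz. -/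
theorem exists_lipschitz_admissible {X : Type*} [PseudoMetricSpace X] [ProperSpace X] {T : ℝ}
    {Ω : Set X} (hΩ : IsOpen Ω) {f : ℝ → X → ℂ}
    (hf : ContinuousOn (fun p : ℝ × X => f p.1 p.2) (Icc 0 T ×ˢ Ω)) :
    ∃ e : X → ℝ, (∀ p q, e p - e q ≤ dist p q) ∧ (∀ z ∈ Ω, 0 < e z) ∧ (∀ z ∉ Ω, e z = 0) ∧
      (∀ z, e z ≤ 1) ∧ ∀ z ∈ Ω, e z / 2 ∈ admissibleRadii T Ω f z := by
  have hbdd : ∀ z, BddAbove (admissibleRadii T Ω f z) := fun z => ⟨1, fun r hr => hr.2.1⟩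
  have hnn : ∀ z, 0 ≤ sSup (admissibleRadii T Ω f z) := fun z =>
    Real.sSup_nonneg fun r hr => hr.1.le
  have hshrink : ∀ p q r, r ∈ admissibleRadii T Ω f p → dist p q < r →
      r - dist p q ∈ admissibleRadii T Ω f q := by
    rintro p q r ⟨h0, h1, h2, h3⟩ hd
    have hsub : closedBall q (r - dist p q) ⊆ closedBall p r :=
      closedBall_subset_closedBall' (by rw [dist_comm q p]; linarith)
    have hpos : 0 < r - dist p q := by linarith
    refine ⟨hpos, by linarith [dist_nonneg (x := p) (y := q)], hsub.trans h2,
      fun t ht y hy => (h3 t ht y (hsub hy)).trans ?_⟩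
    exact one_div_le_one_div_of_le hpos (by linarith [dist_nonneg (x := p) (y := q)])
  have hpos : ∀ z ∈ Ω, 0 < sSup (admissibleRadii T Ω f z) := by
    intro z hz
    obtain ⟨r, hr, hrΩ⟩ := nhds_basis_closedBall.mem_iff.1 (hΩ.mem_nhds hz)
    obtain ⟨C, hC⟩ := ((isCompact_Icc (a := 0) (b := T)).prod
      (isCompact_closedBall z r)).exists_bound_of_continuousOn (hf.mono (prod_mono Subset.rfl hrΩ))
    have hm : 0 < max C 1 := by positivity
    have hmem : min (min r 1) (1 / max C 1) ∈ admissibleRadii T Ω f z := by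
      have h1 : min (min r 1) (1 / max C 1) ≤ r := (min_le_left _ _).trans (min_le_left _ _)
      have h2 : 0 < min (min r 1) (1 / max C 1) := by positivity
      refine ⟨h2, (min_le_left _ _).trans (min_le_right _ _),
        (closedBall_subset_closedBall h1).trans hrΩ, fun t ht y hy => ?_⟩
      refine (hC (t, y) ⟨ht, closedBall_subset_closedBall h1 hy⟩).trans
        ((le_max_left C 1).trans ?_)
      rw [le_div_iff₀ h2]
      have h3 := (le_div_iff₀ hm).1 (min_le_right (min r 1) (1 / max C 1))
      linarith
    exact hmem.1.trans_le (le_csSup (hbdd z) hmem)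
  refine ⟨fun z => sSup (admissibleRadii T Ω f z), fun p q => ?_, hpos, fun z hz => ?_,
    fun z => Real.sSup_le (fun r hr => hr.2.1) zero_le_one, fun z hz => ?_⟩
  · rw [sub_le_iff_le_add]
    refine Real.sSup_le (fun r hr => ?_) (add_nonneg dist_nonneg (hnn q))
    rcases lt_or_ge (dist p q) r with hd | hd
    · linarith [le_csSup (hbdd q) (hshrink p q r hr hd)]
    · linarith [hnn q]
  -- Off `Ω` no radius is admissible, and `sSup ∅ = 0` is the value wanted.
  · have : admissibleRadii T Ω f z = ∅ := eq_empty_of_forall_notMem fun r hr =>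
      hz (hr.2.2.1 (mem_closedBall_self hr.1.le))
    simp [this]
  · have h0 := hpos z hz
    have hne : (admissibleRadii T Ω f z).Nonempty := by
      by_contra hcon
      rw [not_nonempty_iff_eq_empty.1 hcon, Real.sSup_empty] at h0
      exact lt_irrefl _ h0
    obtain ⟨r, hr, hlt⟩ := exists_lt_of_lt_csSup hne (half_lt_self h0)
    have hsub : closedBall z (sSup (admissibleRadii T Ω f z) / 2) ⊆ closedBall z r :=
      closedBall_subset_closedBall hlt.le
    exact ⟨by linarith, by linarith [hr.2.1], hsub.trans hr.2.2.1, fun t ht y hy =>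
      (hr.2.2.2 t ht y (hsub hy)).trans (one_div_le_one_div_of_le (by linarith) hlt.le)⟩

end Existence

end EllipticCR
end

theorem theorem2 (α β : ℝ) (hell : 0 < 4 * α - β ^ 2)
    (Ω : Set (ℝ × ℝ)) (hopen : IsOpen Ω) (hconn : IsConnected Ω)
    (hbdd : Bornology.IsBounded Ω) (T : ℝ) (hT : 0 < T)
    (S : EllipticCR.RealSystem) (hS : S.IsContinuous T Ω) :
    -- associated exactly when the coefficients have the stated form
    (S.IsAssociated α β T Ω ↔
      ∃ A E G : ℝ → ℝ × ℝ → EllipticCR.Num α β, S.IsGivenBy T Ω A E G) ∧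
    -- for such systems the initial value problem is solvable
    ∀ A E G : ℝ → ℝ × ℝ → EllipticCR.Num α β, S.IsGivenBy T Ω A E G →
      -- along a suitable exhaustion
      (∃ (s₀ : ℝ) (D : ℝ → Set (ℝ × ℝ)),
        EllipticCR.IsExhaustion Ω s₀ D ∧ EllipticCR.IsFoliated Ω s₀ D ∧
        ∃ h₀ > 0, h₀ * s₀ ≤ T ∧ ∀ h, 0 < h → h ≤ h₀ → S.IsSolvableAlong α β Ω s₀ D h) ∧
      -- and along every exhaustion, if the leading coefficient is bounded
      ((∃ M : ℝ, ∀ t ∈ Set.Icc 0 T, ∀ z ∈ Ω, |(A t z).re| ≤ M ∧ |(A t z).im| ≤ M) →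
        ∀ (s₀ : ℝ) (D : ℝ → Set (ℝ × ℝ)), EllipticCR.IsExhaustion Ω s₀ D →
          ∃ h₀ > 0, h₀ * s₀ ≤ T ∧ ∀ h, 0 < h → h ≤ h₀ → S.IsSolvableAlong α β Ω s₀ D h) := by
  obtain ⟨l, hl, him⟩ : ∃ l : ℂ, l * l = -α - β * l ∧ l.im ≠ 0 := by
    have hsq := Real.mul_self_sqrt hell.le
    refine ⟨⟨-β / 2, Real.sqrt (4 * α - β ^ 2) / 2⟩, ?_, by positivity⟩
    apply Complex.ext <;> simp
    · linear_combination (-1 / 4) * hsq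
    · ring
  have hα : 0 < α := by nlinarith [sq_nonneg β]
  refine ⟨⟨fun h => h.exists_isGivenBy hα hl him hopen, fun ⟨A, E, G, h⟩ =>
    h.isAssociated hl him hopen⟩, fun A E G h => ?_⟩
  obtain ⟨c, hc, hsol⟩ := h.exists_solution hα hl him hT hopen hS
  constructor
  · have hcA : ContinuousOn (fun p : ℝ × (ℝ × ℝ) => EllipticCR.toComplex l (A p.1 p.2))
        (Set.Icc 0 T ×ˢ Ω) :=
      (Complex.continuous_ofReal.comp_continuousOn (h.continuousOn_A hα hS).1).add
        ((Complex.continuous_ofReal.comp_continuousOn (h.continuousOn_A hα hS).2).mul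
          continuousOn_const)
    obtain ⟨e, hlip, hpos, hoff, hle, hadm⟩ :=
      EllipticCR.exists_lipschitz_admissible (T := T)
        (f := fun t z => EllipticCR.toComplex l (A t z)) hopen hcA
    obtain ⟨D, hD, hfol, c', hc', hDe⟩ :=
      EllipticCR.exists_foliated_exhaustion hopen hconn hlip hpos hoff hle
    -- Radius `e / 2` and bound `2 / e` require `t < c e ^ 2 / 4`; since `c' (1 - s) ≤ e ^ 2`, the
    -- factor `1 / 8` makes this strict.
    refine ⟨1, D, hD, hfol, min T (c * c' / 8), by positivity, by
      rw [mul_one]; exact min_le_left _ _, fun k hk hk₀ => ?_⟩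
    refine EllipticCR.isSolvableAlong_of_isSolutionAt fun ρ hρ => ?_
    obtain ⟨w, hw0, hw⟩ := hsol ρ hρ
    refine ⟨w, hw0, fun s hs z hz t ht => ?_⟩
    have hzΩ : z ∈ Ω := by
      rw [← hD.iUnion_eq]; exact Set.mem_biUnion hs hz
    have hez := hpos z hzΩ
    obtain ⟨h1, -, h2, h3⟩ := hadm z hzΩ
    have h4 := hDe s hs z hz
    have h5 : t ≤ k * (1 - s) := ht.2
    have hs1 : 0 < 1 - s := by linarith [hs.2]
    have h6 : k * (1 - s) ≤ T * (1 - s) :=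
      mul_le_mul_of_nonneg_right (hk₀.trans (min_le_left _ _)) hs1.le
    have h7 : k * (1 - s) ≤ c * c' / 8 * (1 - s) :=
      mul_le_mul_of_nonneg_right (hk₀.trans (min_le_right _ _)) hs1.le
    refine hw z (e z / 2) (1 / (e z / 2)) t h2 h1 (by positivity) h3
      ⟨ht.1, by nlinarith [hs.1]⟩ ?_
    rw [div_mul_eq_mul_div, one_mul, div_lt_iff₀ h1]
    have h8 : c * (c' * (1 - s)) ≤ c * e z ^ 2 := mul_le_mul_of_nonneg_left h4 hc.le
    have h9 : 0 < c * e z ^ 2 := by positivity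
    nlinarith
  · rintro ⟨M, hM⟩ s₀ D hD
    obtain ⟨c', hc', hdist⟩ := hD.le_dist
    have hs₀ := hD.pos
    set K : ℝ := |M| * (1 + ‖l‖) + 1
    have hK : 0 < K := by positivity
    have hAK : ∀ t ∈ Set.Icc 0 T, ∀ z ∈ Ω, ‖EllipticCR.toComplex l (A t z)‖ ≤ K := by
      intro t ht z hz
      obtain ⟨h1, h2⟩ := hM t ht z hz
      have h3 : ‖EllipticCR.toComplex l (A t z)‖ ≤ |(A t z).re| + |(A t z).im| * ‖l‖ := by
        refine (norm_add_le _ _).trans (le_of_eq ?_)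
        rw [norm_mul, Complex.norm_real, Complex.norm_real, Real.norm_eq_abs, Real.norm_eq_abs]
      have h4 : |(A t z).im| * ‖l‖ ≤ |M| * ‖l‖ :=
        mul_le_mul_of_nonneg_right (h2.trans (le_abs_self M)) (norm_nonneg l)
      have := h1.trans (le_abs_self M)
      simp only [K]
      linarith
    -- Balls of radius `c' (s₀ - s) / 2` stay in `Ω` and require `K t < c c' (s₀ - s) / 2`; a
    -- quarter in place of the half makes this strict.
    refine ⟨min (T / s₀) (c * c' / (4 * K)), by positivity, ?_, fun k hk hk₀ => ?_⟩
    · exact (le_div_iff₀ hs₀).1 (min_le_left _ _)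
    refine EllipticCR.isSolvableAlong_of_isSolutionAt fun ρ hρ => ?_
    obtain ⟨w, hw0, hw⟩ := hsol ρ hρ
    refine ⟨w, hw0, fun s hs z hz t ht => ?_⟩
    have hs1 : 0 < s₀ - s := by linarith [hs.2]
    have hball : Metric.closedBall z (c' * (s₀ - s) / 2) ⊆ Ω := by
      intro y hy
      by_contra hcon
      have h1 := hdist s hs z hz y hcon
      have h2 := Metric.mem_closedBall'.1 hy
      have : 0 < c' * (s₀ - s) := by positivity
      linarith
    have h1 : k * s₀ ≤ T := (le_div_iff₀ hs₀).1 (hk₀.trans (min_le_left _ _))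
    have h2 : k * (4 * K) ≤ c * c' :=
      (le_div_iff₀ (by positivity)).1 (hk₀.trans (min_le_right _ _))
    refine hw z (c' * (s₀ - s) / 2) K t hball (by positivity) hK
      (fun t ht y hy => hAK t ht y (hball hy))
      ⟨ht.1, by nlinarith [ht.2, hs.1]⟩ ?_
    have h3 : K * t ≤ K * (k * (s₀ - s)) := mul_le_mul_of_nonneg_left ht.2 hK.le
    have h4 : k * (4 * K) * (s₀ - s) ≤ c * c' * (s₀ - s) :=
      mul_le_mul_of_nonneg_right h2 hs1.le
    have h5 : 0 < c * c' * (s₀ - s) := by positivity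
    nlinarith
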